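/- Let $A\to M$ be a smooth real vector bundle of finite rank over a (Hausdorff, $\sigma$-compact, finite-dimensional) smooth manifold, and let $\mathcal E=T^*\Pi A$, where $C^\infty(\Pi A)=\Gamma(\bigwedge A^*)$. Let $\mathcal C=\bigoplus_{k,l}\mathcal C^{k,l}$ be the bigraded algebra of polynomial functions on $\mathcal E$, where the Darboux coordinates $x^i,\xi^a,\theta_a,p_i$ have bidegrees $(0,0),(0,1),(1,0),(1,1)$, with the canonical even Poisson bracket $\{\cdot,\cdot\}$ of bidegree $(-1,-1)$, normalised by $\{p_i,x^j\}=\delta_i^j$, $\{\theta_a,\xi^b\}=\delta_a^b$; thus $\mathcal C^{0,l}=\Gamma(\bigwedge^l A^*)$ and $\mathcal C^{k,0}=\Gamma(\bigwedge^k A)$. The total weight of $\mathcal C^{k,l}$ is $k+l$. For $\mu\in\mathcal C^{1,2}$, $\gamma\in\mathcal C^{2,1}$, $\phi\in\mathcal C^{0,3}$, $\psi\in\mathcal C^{3,0}$ put $\Theta=\mu+\gamma+\phi+\psi$, $d_\mu=\{\mu,\cdot\}$, $d_\gamma=\{\gamma,\cdot\}$, $[X,Y]_\mu=\{\{X,\mu\},Y\}$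 for $X,Y\in\Gamma(\bigwedge A)$ and $[\alpha,\beta]_\gamma=\{\{\alpha,\gamma\},\beta\}$ for $\alpha,\beta\in\Gamma(\bigwedge A^*)$. The quadruple $(\mu,\gamma,\phi,\psi)$ is a proto-Lie bialgebroid on $(A,A^*)$ if $\{\Theta,\Theta\}=0$. The triple $(\mu,\gamma,\phi)$ is a quasi-Lie bialgebroid on $(A,A^*)$ if $\frac12\{\mu,\mu\}+\{\gamma,\phi\}=0$, $\{\gamma,\gamma\}=0$, $\{\mu,\gamma\}=0$, $\{\mu,\phi\}=0$; the triple $(\mu,\gamma,\psi)$ is a quasi-Lie bialgebroid on $(A^*,A)$ if $\frac12\{\gamma,\gamma\}+\{\mu,\psi\}=0$, $\{\mu,\mu\}=0$, $\{\mu,\gamma\}=0$, $\{\gamma,\psi\}=0$. For a degree-one vector field $v$ on $\Pi A$ (resp. $\Pi A^*$), $h_v\in\mathcal C^{1,2}$ (resp. $\mathcal C^{2,1}$) is the linear Hamiltonian with $\{h_v,f\}=v(f)$ for $f\in\Gamma(\bigwedge A^*)$ (resp. $f\in\Gamma(\bigwedge A)$). For a bilinear form $B$ write $\tilde B(x)=B(x,\cdot)$.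 For $\omega\in\Gamma(\bigwedge^2A^*)$, $\bigwedge^j\tilde\omega\,\psi\in\Gamma(\bigwedge^{3-j}A\otimes\bigwedge^jA^*)$ is $\psi$ with $j$ indices lowered, $(\bigwedge^j\tilde\omega\,\psi)(\alpha_1,\dots,\alpha_{3-j},X_1,\dots,X_j)=\psi(\alpha_1,\dots,\alpha_{3-j},\tilde\omega X_1,\dots,\tilde\omega X_j)$, the values being taken by successive contraction; $\bigwedge^j\tilde\pi\,\phi$ is defined likewise for $\pi\in\Gamma(\bigwedge^2A)$ by raising $j$ indices of $\phi$. Write $X_H=\{H,\cdot\}$. **(0)** For $H=\omega\in\Gamma(\bigwedge^2A^*)$ or $H=\pi\in\Gamma(\bigwedge^2A)$, every $F\in\mathcal C$ is killed by a power of $X_H$, and the flow $\exp(tX_H)=\sum_n\frac{t^n}{n!}X_H^n$, $t\in\mathbb R$, is a one-parameter group of canonical transformations, i.e. of algebra automorphisms of $\mathcal C$ that preserve the Poisson bracket and the total weight. In particular this holds for the time-1 flows $\exp X_\omega$ and $\exp X_\pi$. **(1)** For $\omega\in\Gamma(\bigwedge^2A^*)$ and arbitrary $\mu,\gamma,\phi,\psi$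 as above, $(\exp X_\omega)\Theta=\mu_\omega+\gamma_\omega+\phi_\omega+\psi$ with $\mu_\omega\in\mathcal C^{1,2}$, $\gamma_\omega\in\mathcal C^{2,1}$, $\phi_\omega\in\mathcal C^{0,3}$ given by $$\begin{aligned}\mu_\omega&=\mu+X_\omega\gamma+\tfrac12X_\omega^2\psi=\mu+h_{[\omega,\cdot]_\gamma}+\textstyle\bigwedge^2\tilde\omega\,\psi,\\ \gamma_\omega&=\gamma+X_\omega\psi=\gamma+\tilde\omega\psi,\\ \phi_\omega&=\phi+X_\omega\mu+\tfrac12X_\omega^2\gamma+\tfrac16X_\omega^3\psi=\phi-d_\mu\omega-\tfrac12[\omega,\omega]_\gamma+\textstyle\bigwedge^3\tilde\omega\,\psi.\end{aligned}$$ Moreover $(\mu_\omega,\gamma_\omega,\phi_\omega,\psi)$ is a proto-Lie bialgebroid if and only if $(\mu,\gamma,\phi,\psi)$ is one. If $\psi=0$ and $(\mu,\gamma,\phi)$ is a quasi-Lie bialgebroid on $(A,A^*)$, then so is $(\mu_\omega,\gamma_\omega,\phi_\omega)$. If $\phi=0$, $(\mu,\gamma,\psi)$ is a quasi-Lie bialgebroid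 on $(A^*,A)$ and $d_\mu\omega+\frac12[\omega,\omega]_\gamma=\bigwedge^3\tilde\omega\,\psi$, then $\phi_\omega=0$ and $(\mu_\omega,\gamma_\omega,\psi)$ is a quasi-Lie bialgebroid on $(A^*,A)$. **(2)** For $\pi\in\Gamma(\bigwedge^2A)$ and arbitrary $\mu,\gamma,\phi,\psi$ as above, $(\exp X_\pi)\Theta=\mu_\pi+\gamma_\pi+\phi+\psi_\pi$ with $\mu_\pi\in\mathcal C^{1,2}$, $\gamma_\pi\in\mathcal C^{2,1}$, $\psi_\pi\in\mathcal C^{3,0}$ given by $$\begin{aligned}\mu_\pi&=\mu+X_\pi\phi=\mu+\tilde\pi\phi,\\ \gamma_\pi&=\gamma+X_\pi\mu+\tfrac12X_\pi^2\phi=\gamma+h_{[\pi,\cdot]_\mu}+\textstyle\bigwedge^2\tilde\pi\,\phi,\\ \psi_\pi&=\psi+X_\pi\gamma+\tfrac12X_\pi^2\mu+\tfrac16X_\pi^3\phi=\psi-d_\gamma\pi-\tfrac12[\pi,\pi]_\mu+\textstyle\bigwedge^3\tilde\pi\,\phi.\end{aligned}$$ Moreover $(\mu_\pi,\gamma_\pi,\phi,\psi_\pi)$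 is a proto-Lie bialgebroid if and only if $(\mu,\gamma,\phi,\psi)$ is one. If $\phi=0$ and $(\mu,\gamma,\psi)$ is a quasi-Lie bialgebroid on $(A^*,A)$, then so is $(\mu_\pi,\gamma_\pi,\psi_\pi)$. If $\psi=0$, $(\mu,\gamma,\phi)$ is a quasi-Lie bialgebroid on $(A,A^*)$ and $d_\gamma\pi+\frac12[\pi,\pi]_\mu=\bigwedge^3\tilde\pi\,\phi$, then $\psi_\pi=0$ and $(\mu_\pi,\gamma_\pi,\phi)$ is a quasi-Lie bialgebroid on $(A,A^*)$. -/

import Mathlib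

noncomputable section

set_option linter.unusedSectionVars false

namespace CotangentPiA

/-! ### Sections of a vector bundle as a module over the smooth functions -/

section Sections

open scoped Manifold ContDiff

variable {E : Type*} [NormedAddCommGroup E] [NormedSpace ℝ E]
  {H : Type*} [TopologicalSpace H] {I : ModelWithCorners ℝ E H}
  {M : Type*} [TopologicalSpace M] [ChartedSpace H M]
  {F : Type*} [NormedAddCommGroup F] [NormedSpace ℝ F]
  {A : M → Type*} [TopologicalSpace (Bundle.TotalSpace F A)]
  [∀ x, AddCommGroup (A x)] [∀ x, Module ℝ (A x)] [∀ x, TopologicalSpace (A x)]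
  [FiberBundle F A] [VectorBundle ℝ F A]

/-- Pointwise multiplication of a smooth section by a smooth function. -/
instance sectionSMul : SMul C^∞⟮I, M; 𝓘(ℝ, ℝ), ℝ⟯ Cₛ^∞⟮I; F, A⟯ :=
  ⟨fun f s => ⟨fun x => f x • s x, f.contMDiff.smul_section s.contMDiff⟩⟩

/-- `Γ(A)` is a module over `C^∞(M)`. -/
instance sectionModule : Module C^∞⟮I, M; 𝓘(ℝ, ℝ), ℝ⟯ Cₛ^∞⟮I; F, A⟯ where
  one_smul s := ContMDiffSection.ext fun x => one_smul ℝ (s x)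
  mul_smul f g s := ContMDiffSection.ext fun x => mul_smul (f x) (g x) (s x)
  smul_zero f := ContMDiffSection.ext fun x => smul_zero (f x)
  smul_add f s t := ContMDiffSection.ext fun x => smul_add (f x) (s x) (t x)
  add_smul f g s := ContMDiffSection.ext fun x => add_smul (f x) (g x) (s x)
  zero_smul s := ContMDiffSection.ext fun x => zero_smul ℝ (s x)

end Sections

/-! ### Functions on `T^*ΠA`

Below `R = C^∞(M)` and `P = Γ(A)`, although the definitions make sense for every module `P` over a
commutative `ℝ`-algebra `R`. -/

section Algebraic

variable (R P : Type*) [CommRing R] [Algebra ℝ R] [AddCommGroup P] [Module R P]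

/-- The algebra `C^∞(ΠA) = Γ(⋀ A^*)`: the exterior algebra of `Γ(A^*) = Hom_R(Γ(A), R)`. -/
abbrev Form := ExteriorAlgebra R (Module.Dual R P)

/-- A function `F` on `T^*ΠA` which is polynomial along the fibres of `T^*ΠA → ΠA` is encoded by all
of its iterated Poisson brackets with functions on `ΠA`, restricted to the zero section:
`F [f₁, …, fₖ] = {…{{F, f₁}, f₂}…, fₖ}` at zero momenta. Its component of degree `k` in the momenta
is thereby a graded symmetric `k`-derivation of `Γ(⋀ A^*)` (for `k = 0` a form, for `k = 1` a vector
field on `ΠA`, regarded as a linear Hamiltonian). The type `Fn` is the ambient space of all maps;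
the functions on `T^*ΠA` are the elements of the submodule `Poly` below. -/
abbrev Fn := List (Form R P) → Form R P

variable {R P}

/-- The parity involution of `Γ(⋀ A^*)`. -/
def parity (f : Form R P) : Form R P := CliffordAlgebra.involute f

/-- The even part of a form. -/
def ev (f : Form R P) : Form R P := (1 / 2 : ℝ) • (f + parity f)

/-- The odd part of a form. -/
def od (f : Form R P) : Form R P := (1 / 2 : ℝ) • (f - parity f)

/-- The forms of degree `n` (none but zero for negative `n`). -/
def formDeg (n : ℤ) : Submodule ℝ (Form R P) :=
  if 0 ≤ n then (⋀[R]^n.toNat (Module.Dual R P)).restrictScalars ℝ else ⊥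

namespace Fn

/-- The parity involution `F ↦ (-1)^{|F|} F`. -/
def par (F : Fn R P) : Fn R P := fun l => parity (F (l.map parity))

/-- `pd F f` is `{F, f}` for a function `f` on `ΠA`. -/
def pd (F : Fn R P) (f : Form R P) : Fn R P := fun l => F (f :: l)

/-- The constant function `1`. -/
def unit : Fn R P
  | [] => 1
  | _ :: _ => 0

/-- The product of functions, determined by the product of forms and
`{F G, f} = F {G, f} + (-1)^{|G||f|} {F, f} G`. -/
def mul : Fn R P → Fn R P → Fn R P
  | F, G, [] => F [] * G []
  | F, G, f :: l => mul F (pd G f) l + mul (pd F (ev f)) G l + mul (pd F (od f)) (par G) l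

/-- The canonical (even) Poisson bracket, determined by `{D, f} = D f = -(-1)^{|D||f|} {f, D}` for
vector fields `D` and functions `f` on `ΠA`, by `{f, g} = 0` for functions `f`, `g` on `ΠA`, and by
the Jacobi identity `{{F, G}, f} = {F, {G, f}} + (-1)^{|G||f|} {{F, f}, G}`. In Darboux coordinates
`{p_i, x^j} = δ_i^j = -{x^j, p_i}` and `{θ_a, ξ^b} = δ_a^b = {ξ^b, θ_a}`. -/
def br : Fn R P → Fn R P → Fn R P
  | F, G, [] => F [G []] - (G [ev (F [])] + par G [od (F [])])
  | F, G, f :: l => br F (pd G f) l + br (pd F (ev f)) G l + br (pd F (od f)) (par G) l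

end Fn

open Fn

/-- `F` is a function on `T^*ΠA` of bidegree `(k, l)`, where `ξ^a`, `θ_a`, `p_i` have bidegrees
`(0,1)`, `(1,0)`, `(1,1)`: a graded symmetric `ℝ`-multilinear `k`-derivation of `Γ(⋀ A^*)`
that raises the form degree by `l - k`. -/
structure IsBihomogeneous (k l : ℕ) (F : Fn R P) : Prop where
  arity : ∀ fs : List (Form R P), fs.length ≠ k → F fs = 0
  multilinear : ∀ (l₁ l₂ : List (Form R P)) (c : ℝ) (f g : Form R P),
    F (l₁ ++ (c • f + g) :: l₂) = c • F (l₁ ++ f :: l₂) + F (l₁ ++ g :: l₂)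
  symmetric : ∀ (l₁ l₂ : List (Form R P)) (p q : ℕ) (f g : Form R P),
    f ∈ ⋀[R]^p (Module.Dual R P) → g ∈ ⋀[R]^q (Module.Dual R P) →
    F (l₁ ++ f :: g :: l₂) = (-1 : ℝ) ^ (p * q) • F (l₁ ++ g :: f :: l₂)
  /-- `G (f g) = (G f) g + (-1)^{|G||f|} f (G g)` for `G = {…{F, f₁}…, fₖ₋₁}`. -/
  leibniz : ∀ (l₁ : List (Form R P)) (f g : Form R P),
    F (l₁ ++ [f * g]) =
      F (l₁ ++ [f]) * g + ev f * F (l₁ ++ [g]) + od f * parity (F (l₁ ++ [parity g]))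
  degree : ∀ (fs : List (Form R P)) (a : List ℕ),
    List.Forall₂ (fun f n => f ∈ ⋀[R]^n (Module.Dual R P)) fs a →
    F fs ∈ formDeg ((a.sum : ℤ) + l - k)

lemma parity_add (f g : Form R P) : parity (f + g) = parity f + parity g := map_add _ _ _

lemma parity_zero : parity (0 : Form R P) = 0 := map_zero _

lemma parity_smul (c : ℝ) (f : Form R P) : parity (c • f) = c • parity f :=
  map_smul (CliffordAlgebra.involute.restrictScalars ℝ) c f

/-- The space `C^{k,l}` of functions on `T^*ΠA` of bidegree `(k, l)`. In particular
`C^{0,l} = Γ(⋀^l A^*)` and `C^{k,0} = Γ(⋀^k A)`. -/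
def bi (k l : ℕ) : Submodule ℝ (Fn R P) where
  carrier := {F | IsBihomogeneous k l F}
  zero_mem' :=
    { arity := fun _ _ => rfl
      multilinear := fun _ _ _ _ _ => by simp
      symmetric := fun _ _ _ _ _ _ _ _ => by simp
      leibniz := fun _ _ _ => by simp [parity_zero]
      degree := fun _ _ _ => Submodule.zero_mem _ }
  add_mem' {F G} hF hG :=
    { arity := fun fs h => by simp [hF.arity fs h, hG.arity fs h]
      multilinear := fun l₁ l₂ c f g => by
        simp only [Pi.add_apply, hF.multilinear, hG.multilinear, smul_add]; abel
      symmetric := fun l₁ l₂ p q f g hf hg => by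
        simp only [Pi.add_apply, smul_add]
        rw [hF.symmetric l₁ l₂ p q f g hf hg, hG.symmetric l₁ l₂ p q f g hf hg]
      leibniz := fun l₁ f g => by
        simp only [Pi.add_apply, hF.leibniz, hG.leibniz, parity_add, mul_add, add_mul]; abel
      degree := fun fs a h => Submodule.add_mem _ (hF.degree fs a h) (hG.degree fs a h) }
  smul_mem' c F hF :=
    { arity := fun fs h => by simp [hF.arity fs h]
      multilinear := fun l₁ l₂ b f g => by
        simp only [Pi.smul_apply, hF.multilinear, smul_add, smul_comm c b]
      symmetric := fun l₁ l₂ p q f g hf hg => by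
        simp only [Pi.smul_apply]
        rw [hF.symmetric l₁ l₂ p q f g hf hg, smul_comm]
      leibniz := fun l₁ f g => by
        simp only [Pi.smul_apply, hF.leibniz, parity_smul, smul_add, smul_mul_assoc, mul_smul_comm]
      degree := fun fs a h => Submodule.smul_mem _ c (hF.degree fs a h) }

variable (R P) in
/-- The algebra of polynomial functions on `T^*ΠA`. -/
def Poly : Submodule ℝ (Fn R P) := ⨆ (k : ℕ) (l : ℕ), bi k l

/-- The functions of total weight `n`. -/
def wt (n : ℕ) : Submodule ℝ (Fn R P) := ⨆ (k : ℕ) (l : ℕ) (_ : k + l = n), bi k l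

/-! ### Hamiltonian flows and canonical transformations -/

/-- (The pullback of functions by) the time-`t` flow of the Hamiltonian vector field
`X_H = {H, ·}`: the exponential series `∑ₙ tⁿ/n! X_Hⁿ F`, for `F` killed by a power of `X_H`. -/
def flow (H : Fn R P) (t : ℝ) (F : Fn R P) : Fn R P :=
  ∑ᶠ n : ℕ, (t ^ n / (n.factorial : ℝ)) • (br H)^[n] F

/-- `Φ` is (the pullback of functions by) a canonical transformation of `T^*ΠA` that preserves the
total weight: an automorphism of the algebra of functions that preserves the Poisson bracket. -/
structure IsCanonicalTransformation (Φ : Fn R P → Fn R P) : Prop where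
  bijOn : Set.BijOn Φ (Poly R P) (Poly R P)
  map_add : ∀ F ∈ Poly R P, ∀ G ∈ Poly R P, Φ (F + G) = Φ F + Φ G
  map_smul : ∀ c : ℝ, ∀ F ∈ Poly R P, Φ (c • F) = c • Φ F
  map_unit : Φ unit = unit
  map_mul : ∀ F ∈ Poly R P, ∀ G ∈ Poly R P, Φ (mul F G) = mul (Φ F) (Φ G)
  map_br : ∀ F ∈ Poly R P, ∀ G ∈ Poly R P, Φ (br F G) = br (Φ F) (Φ G)
  map_wt : ∀ n : ℕ, ∀ F ∈ wt n, Φ F ∈ wt n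

/-- The Hamiltonian vector field `X_H` is locally nilpotent on functions, so that its exponential
series terminates on each of them, and the flow is a one-parameter group of canonical
transformations. -/
structure HasCanonicalFlow (H : Fn R P) : Prop where
  locallyNilpotent : ∀ F ∈ Poly R P, ∃ N : ℕ, ∀ n ≥ N, (br H)^[n] F = 0
  flow_zero : ∀ F ∈ Poly R P, flow H 0 F = F
  flow_add : ∀ s t : ℝ, ∀ F ∈ Poly R P, flow H (s + t) F = flow H s (flow H t F)
  canonical : ∀ t : ℝ, IsCanonicalTransformation (flow H t)

/-! ### Proto- and quasi-Lie bialgebroids -/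

/-- A proto-Lie bialgebroid structure on `(A, A^*)`: a cubic `Θ = μ + γ + φ + ψ` with
`{Θ, Θ} = 0`. -/
structure IsProtoLieBialgebroid (μ γ φ ψ : Fn R P) : Prop where
  mu_mem : μ ∈ bi 1 2
  gamma_mem : γ ∈ bi 2 1
  phi_mem : φ ∈ bi 0 3
  psi_mem : ψ ∈ bi 3 0
  structure_eq : br (μ + γ + φ + ψ) (μ + γ + φ + ψ) = 0

/-- A quasi-Lie bialgebroid structure on `(A, A^*)`. -/
structure IsQuasiLieBialgebroid (μ γ φ : Fn R P) : Prop where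
  mu_mem : μ ∈ bi 1 2
  gamma_mem : γ ∈ bi 2 1
  phi_mem : φ ∈ bi 0 3
  mu_mu : (1 / 2 : ℝ) • br μ μ + br γ φ = 0
  gamma_gamma : br γ γ = 0
  mu_gamma : br μ γ = 0
  mu_phi : br μ φ = 0

/-- A quasi-Lie bialgebroid structure on `(A^*, A)`: the roles of `μ` and `γ` are exchanged. -/
structure IsDualQuasiLieBialgebroid (μ γ ψ : Fn R P) : Prop where
  mu_mem : μ ∈ bi 1 2
  gamma_mem : γ ∈ bi 2 1
  psi_mem : ψ ∈ bi 3 0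
  gamma_gamma : (1 / 2 : ℝ) • br γ γ + br μ ψ = 0
  mu_mu : br μ μ = 0
  mu_gamma : br μ γ = 0
  gamma_psi : br γ ψ = 0

/-- The (quasi-)differentials `d_μ = {μ, ·}` on `Γ(⋀ A^*)` and `d_γ = {γ, ·}` on `Γ(⋀ A)`. -/
def diff (Q F : Fn R P) : Fn R P := br Q F

/-- The derived brackets `[X, Y]_μ = {{X, μ}, Y}` on `Γ(⋀ A)` and `[α, β]_γ = {{α, γ}, β}` on
`Γ(⋀ A^*)`. -/
def derived (Q F G : Fn R P) : Fn R P := br (br F Q) G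

/-- `h = h_v` is the linear Hamiltonian on `T^*ΠA` of the vector field `v` on `ΠA`, where `v` has
degree `1`. -/
def IsLinearHamiltonian (v : Fn R P → Fn R P) (h : Fn R P) : Prop :=
  h ∈ bi 1 2 ∧ ∀ l : ℕ, ∀ f ∈ bi 0 l, br h f = v f

/-- `h = h_v` is the linear Hamiltonian on `T^*ΠA^* = T^*ΠA` of the vector field `v` on `ΠA^*`,
where `v` has degree `1`. -/
def IsDualLinearHamiltonian (v : Fn R P → Fn R P) (h : Fn R P) : Prop :=
  h ∈ bi 2 1 ∧ ∀ k : ℕ, ∀ X ∈ bi k 0, br h X = v X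

/-- For a bilinear form `B` in `Γ(⋀² A^*)` (or `Γ(⋀² A)`) the map `B̃ : A → A^*` (or `A^* → A`),
`B̃(x) = B(x, ·)`: the contraction of `B` with `x`. -/
def tilde (B x : Fn R P) : Fn R P := br x B

/-- The value of a tensor on a list of sections of `A` and `A^*`, by successive contraction. -/
def contract (T : Fn R P) (xs : List (Fn R P)) : Fn R P := xs.foldl br T

/-- `T = ⋀ʲω̃ ψ` is the tensor in `Γ(⋀^{3-j} A ⊗ ⋀^j A^*)` obtained from `ψ ∈ Γ(⋀³ A)` by lowering `j`
indices with `ω̃`: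
`T(α₁, …, α₃₋ⱼ, X₁, …, Xⱼ) = ψ(α₁, …, α₃₋ⱼ, ω̃ X₁, …, ω̃ Xⱼ)`.
(A function is a tensor, that is, a section of `⋀ A ⊗ ⋀ A^*`, when it commutes with the functions
on `M`; a tensor is determined by its values.) -/
def IsLowering (j : ℕ) (ω ψ T : Fn R P) : Prop :=
  T ∈ bi (3 - j) j ∧ (∀ f ∈ bi 0 0, br T f = 0) ∧
  ∀ α X : List (Fn R P), α.length = 3 - j → X.length = j →
    (∀ a ∈ α, a ∈ bi 0 1) → (∀ x ∈ X, x ∈ bi 1 0) →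
    contract T (α ++ X) = contract ψ (α ++ X.map (tilde ω))

/-- `T = ⋀ʲπ̃ φ` is the tensor in `Γ(⋀^j A ⊗ ⋀^{3-j} A^*)` obtained from `φ ∈ Γ(⋀³ A^*)` by raising
`j` indices with `π̃`:
`T(X₁, …, X₃₋ⱼ, α₁, …, αⱼ) = φ(X₁, …, X₃₋ⱼ, π̃ α₁, …, π̃ αⱼ)`. -/
def IsRaising (j : ℕ) (π φ T : Fn R P) : Prop :=
  T ∈ bi j (3 - j) ∧ (∀ f ∈ bi 0 0, br T f = 0) ∧
  ∀ X α : List (Fn R P), X.length = 3 - j → α.length = j →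
    (∀ x ∈ X, x ∈ bi 1 0) → (∀ a ∈ α, a ∈ bi 0 1) →
    contract T (X ++ α) = contract φ (X ++ α.map (tilde π))

end Algebraic

section Bundles

open scoped Manifold ContDiff

/-- The ambient space of the functions on `T^*ΠA` for a smooth vector bundle `A → M` with typical
fibre `F`. -/
abbrev BundleFn {E : Type*} [NormedAddCommGroup E] [NormedSpace ℝ E]
    {H : Type*} [TopologicalSpace H] (I : ModelWithCorners ℝ E H)
    {M : Type*} [TopologicalSpace M] [ChartedSpace H M]
    (F : Type*) [NormedAddCommGroup F] [NormedSpace ℝ F]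
    (A : M → Type*) [TopologicalSpace (Bundle.TotalSpace F A)]
    [∀ x, AddCommGroup (A x)] [∀ x, Module ℝ (A x)] [∀ x, TopologicalSpace (A x)]
    [FiberBundle F A] [VectorBundle ℝ F A] :=
  Fn C^∞⟮I, M; 𝓘(ℝ, ℝ), ℝ⟯ Cₛ^∞⟮I; F, A⟯

end Bundles

end CotangentPiA

end

open CotangentPiA CotangentPiA.Fn

noncomputable section

set_option linter.unusedSectionVars false

namespace CotangentPiA

section

variable {R P : Type*} [CommRing R] [Algebra ℝ R] [AddCommGroup P] [Module R P]

/-! ### The parity involution of forms -/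

/-! Everything follows from the graded Poisson identities and from counting bidegrees. If `W` has
bidegree `(a, b)`, then `X_W` shifts bidegrees by `(a - 1, b - 1)`. There is nothing in negative
bidegree (`IsMultiderivation.eq_zero`), so for `W = ω` of bidegree `(0, 2)` or `W = π` of bidegree
`(2, 0)` every polynomial function is killed by a power of `X_W`. As `W` is even, the Jacobi
identity (`brₗ_jacobi`) and the Poisson rule (`brₗ_mulₗ`) make `X_W` a derivation, without signs, of
the bracket and of the product. The exponential of a locally nilpotent derivation is an automorphism
(`expSeries_bilinear`), inverted by the flow at time `-t`.

The identities are proved on the encoding of a function by its iterated brackets with forms. The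
bracket of a form with the defect of an identity is a combination of defects of the same identity,
with one entry replaced by its bracket with the form. It then suffices that all defects vanish on
the zero section (`eq_zero_of_pd_mem_span`).

In `(exp X_ω) Θ` the series stop because `X_ω φ`, `X_ω² μ`, `X_ω³ γ` and `X_ω⁴ ψ` have negative
bidegree. Antisymmetry turns `X_ω μ` and `X_ω² γ` into `-d_μ ω` and `-[ω, ω]_γ`. Contracting `X_ω^j
ψ / j!` with `j` sections of `A` lowers `j` indices of `ψ`: each section is moved past the powers of
`X_ω` by the derivation property, and the number of ways cancels the factorial (`contract_ham_pow`).
The case of `π` is the mirror image.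

A canonical transformation is injective and carries `{Θ, Θ}` to the bracket of the twisted `Θ` with
itself, which gives the equivalence for proto-Lie bialgebroids. The bidegree components of `{Θ, Θ}`
vanish separately (`brₗ_self_eq_zero_iff`), so quasi-Lie bialgebroids are the proto-Lie bialgebroids
with `ψ = 0` or `φ = 0`, and their twists are special cases. -/

@[simp] lemma parity_parity (f : Form R P) : parity (parity f) = f :=
  CliffordAlgebra.involute_involute f

@[simp] lemma parity_mul (f g : Form R P) : parity (f * g) = parity f * parity g := map_mul _ _ _

lemma parity_sub (f g : Form R P) : parity (f - g) = parity f - parity g := map_sub _ _ _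

lemma parity_ev (f : Form R P) : parity (ev f) = ev f := by
  simp only [ev, parity_smul, parity_add, parity_parity, add_comm]

lemma parity_od (f : Form R P) : parity (od f) = -od f := by
  simp only [od, parity_smul, parity_sub, parity_parity, ← smul_neg, neg_sub]

lemma ev_parity (f : Form R P) : ev (parity f) = parity (ev f) := by
  simp only [ev, parity_smul, parity_add]

lemma od_parity (f : Form R P) : od (parity f) = parity (od f) := by
  simp only [od, parity_smul, parity_sub]

lemma ev_add_od (f : Form R P) : ev f + od f = f := by
  simp only [ev, od]; module

lemma ev_add (f g : Form R P) : ev (f + g) = ev f + ev g := by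
  simp only [ev, parity_add]; module

lemma od_add (f g : Form R P) : od (f + g) = od f + od g := by
  simp only [od, parity_add]; module

lemma ev_smul (c : ℝ) (f : Form R P) : ev (c • f) = c • ev f := by
  simp only [ev, parity_smul]; module

lemma od_smul (c : ℝ) (f : Form R P) : od (c • f) = c • od f := by
  simp only [od, parity_smul]; module

@[simp] lemma ev_zero : ev (0 : Form R P) = 0 := by simp [ev, parity_zero]

@[simp] lemma od_zero : od (0 : Form R P) = 0 := by simp [od, parity_zero]

/-- `f` is homogeneous of parity `p`. -/
def HasParity (p : ℕ) (f : Form R P) : Prop := parity f = (-1 : ℝ) ^ p • f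

lemma hasParity_ev (f : Form R P) : HasParity 0 (ev f) := by simp [HasParity, parity_ev]

lemma hasParity_od (f : Form R P) : HasParity 1 (od f) := by simp [HasParity, parity_od]

/-- The recursions for `mul` and `br` split an argument into its even and odd parts. For a
homogeneous argument one part vanishes, and the split collapses to the Koszul sign `(-1)^(p q)`;
this is how the signed rules `nilₗ_brₗ`, `pdₗ_brₗ` and `pdₗ_mulₗ` arise. -/
lemma HasParity.ev_od {p : ℕ} {f : Form R P} (h : HasParity p f) :
    ((-1 : ℝ) ^ p = 1 ∧ ev f = f ∧ od f = 0) ∨ ((-1 : ℝ) ^ p = -1 ∧ ev f = 0 ∧ od f = f) := by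
  unfold HasParity at h
  rcases neg_one_pow_eq_or ℝ p with hp | hp
  · left
    rw [hp] at h
    refine ⟨hp, ?_, ?_⟩ <;> simp only [ev, od, h] <;> module
  · right
    rw [hp] at h
    refine ⟨hp, ?_, ?_⟩ <;> simp only [ev, od, h] <;> module

lemma hasParity_of_mem {p : ℕ} {f : Form R P} (h : f ∈ ⋀[R]^p (Module.Dual R P)) :
    HasParity p f := by
  unfold HasParity
  induction h using Submodule.pow_induction_on_left' with
  | algebraMap r => simp [parity]
  | add x y i hx hy ihx ihy => rw [parity_add, ihx, ihy, smul_add]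
  | mem_mul m hm i x hx ih =>
    obtain ⟨a, rfl⟩ := hm
    have : parity (ExteriorAlgebra.ι R a : Form R P) = -ExteriorAlgebra.ι R a :=
      CliffordAlgebra.involute_ι _
    rw [parity_mul, this, ih, mul_smul_comm, pow_succ, neg_mul, smul_neg, mul_neg_one, neg_smul]

/-- Forms are sums of forms of homogeneous degree. -/
lemma form_induction {p : Form R P → Prop} (zero : p 0)
    (add : ∀ f g, p f → p g → p (f + g))
    (homogeneous : ∀ (n : ℕ) (f), f ∈ ⋀[R]^n (Module.Dual R P) → p f) (f : Form R P) : p f := by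
  induction f using DirectSum.Decomposition.inductionOn
    (fun n : ℕ => ⋀[R]^n (Module.Dual R P)) with
  | zero => exact zero
  | homogeneous m => exact homogeneous _ _ m.2
  | add f g hf hg => exact add _ _ hf hg

lemma parity_mem {p : ℕ} {f : Form R P} (h : f ∈ ⋀[R]^p (Module.Dual R P)) :
    parity f ∈ ⋀[R]^p (Module.Dual R P) := by
  rw [hasParity_of_mem h]
  rcases neg_one_pow_eq_or ℝ p with hp | hp <;> simpa [hp] using h

lemma ev_mem {p : ℕ} {f : Form R P} (h : f ∈ ⋀[R]^p (Module.Dual R P)) :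
    ev f ∈ ⋀[R]^p (Module.Dual R P) := by
  rcases (hasParity_of_mem h).ev_od with ⟨-, h1, -⟩ | ⟨-, h1, -⟩ <;> simp [h1, h]

lemma od_mem {p : ℕ} {f : Form R P} (h : f ∈ ⋀[R]^p (Module.Dual R P)) :
    od f ∈ ⋀[R]^p (Module.Dual R P) := by
  rcases (hasParity_of_mem h).ev_od with ⟨-, -, h1⟩ | ⟨-, -, h1⟩ <;> simp [h1, h]

lemma mem_formDeg_iff {n : ℤ} {f : Form R P} :
    f ∈ formDeg n ↔ f = 0 ∨ 0 ≤ n ∧ f ∈ ⋀[R]^n.toNat (Module.Dual R P) := by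
  unfold formDeg
  split_ifs with h
  · simp only [Submodule.restrictScalars_mem, h, true_and]
    constructor
    · exact Or.inr
    · rintro (rfl | h)
      · exact Submodule.zero_mem _
      · exact h
  · simp [h]

lemma parity_mem_formDeg {n : ℤ} {f : Form R P} (h : f ∈ formDeg n) : parity f ∈ formDeg n := by
  rw [mem_formDeg_iff] at h ⊢
  rcases h with rfl | ⟨h, hf⟩
  · exact Or.inl parity_zero
  · exact Or.inr ⟨h, parity_mem hf⟩

/-! ### Multilinear functions -/

/-- The functions that are multilinear over `ℝ`. -/
def multilinearFn (R P : Type*) [CommRing R] [Algebra ℝ R] [AddCommGroup P] [Module R P] :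
    Submodule ℝ (Fn R P) where
  carrier := {F | ∀ (l₁ l₂ : List (Form R P)) (c : ℝ) (f g : Form R P),
    F (l₁ ++ (c • f + g) :: l₂) = c • F (l₁ ++ f :: l₂) + F (l₁ ++ g :: l₂)}
  zero_mem' := fun _ _ _ _ _ => by simp
  add_mem' hF hG := fun l₁ l₂ c f g => by
    simp only [Pi.add_apply, hF l₁ l₂ c f g, hG l₁ l₂ c f g]; module
  smul_mem' b F hF := fun l₁ l₂ c f g => by
    simp only [Pi.smul_apply, hF l₁ l₂ c f g]; module

/-! ### Linearity of the bracket and the product, and their compatibility with parity. -/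

section Multilinear

variable {F F' G G' : Fn R P}

lemma map_add_cons (hF : F ∈ multilinearFn R P) (l : List (Form R P)) (f g : Form R P) :
    F ((f + g) :: l) = F (f :: l) + F (g :: l) := by
  simpa using hF [] l 1 f g

lemma map_zero_cons (hF : F ∈ multilinearFn R P) (l : List (Form R P)) : F (0 :: l) = 0 := by
  have := hF [] l 1 0 0
  simpa using this

lemma map_smul_cons (hF : F ∈ multilinearFn R P) (l : List (Form R P)) (c : ℝ) (f : Form R P) :
    F ((c • f) :: l) = c • F (f :: l) := by
  have := hF [] l c f 0
  simpa [map_zero_cons hF] using this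

lemma pd_add_left (f : Form R P) : pd (F + G) f = pd F f + pd G f := rfl

lemma pd_smul_left (c : ℝ) (f : Form R P) : pd (c • F) f = c • pd F f := rfl

lemma pd_add_right (hF : F ∈ multilinearFn R P) (f g : Form R P) :
    pd F (f + g) = pd F f + pd F g := funext fun l => map_add_cons hF l f g

lemma pd_smul_right (hF : F ∈ multilinearFn R P) (c : ℝ) (f : Form R P) :
    pd F (c • f) = c • pd F f := funext fun l => map_smul_cons hF l c f

lemma pd_zero_right (hF : F ∈ multilinearFn R P) : pd F 0 = 0 :=
  funext fun l => map_zero_cons hF l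

lemma pd_mem_multilinearFn (hF : F ∈ multilinearFn R P) (f : Form R P) :
    pd F f ∈ multilinearFn R P := fun l₁ l₂ c a b => hF (f :: l₁) l₂ c a b

lemma par_add : par (F + G) = par F + par G := funext fun _ => parity_add _ _

lemma par_smul (c : ℝ) : par (c • F) = c • par F := funext fun _ => parity_smul _ _

@[simp] lemma par_par : par (par F) = F := by
  funext l
  simp [par, Function.comp_def]

lemma par_pd (f : Form R P) : par (pd F f) = pd (par F) (parity f) := by
  funext l
  simp [par, pd]

lemma par_mem_multilinearFn (hF : F ∈ multilinearFn R P) : par F ∈ multilinearFn R P := by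
  intro l₁ l₂ c f g
  simp only [par, List.map_append, List.map_cons, parity_add, parity_smul]
  rw [hF, parity_add, parity_smul]

/-- Multilinearity of `G` is needed because the value of `F` on the zero section is inserted into
`G`. For this reason the bracket is treated as bilinear only on multilinear functions. -/
lemma br_add_left (hG : G ∈ multilinearFn R P) : br (F + F') G = br F G + br F' G := by
  funext l
  induction l generalizing F F' G with
  | nil =>
    simp only [br, Pi.add_apply, ev_add, od_add, map_add_cons hG,
      map_add_cons (par_mem_multilinearFn hG)]
    abel
  | cons f l ih =>
    simp only [br, Pi.add_apply, pd_add_left, ih hG, ih (par_mem_multilinearFn hG),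
      ih (pd_mem_multilinearFn hG f)]
    abel

lemma br_smul_left (hG : G ∈ multilinearFn R P) (c : ℝ) : br (c • F) G = c • br F G := by
  funext l
  induction l generalizing F G with
  | nil =>
    simp only [br, Pi.smul_apply, ev_smul, od_smul, map_smul_cons hG,
      map_smul_cons (par_mem_multilinearFn hG), smul_add, smul_sub]
  | cons f l ih =>
    simp only [br, Pi.smul_apply, pd_smul_left, ih hG, ih (par_mem_multilinearFn hG),
      ih (pd_mem_multilinearFn hG f), smul_add]

lemma br_add_right (hF : F ∈ multilinearFn R P) : br F (G + G') = br F G + br F G' := by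
  funext l
  induction l generalizing F G G' with
  | nil =>
    simp only [br, Pi.add_apply, par_add, map_add_cons hF]
    abel
  | cons f l ih =>
    simp only [br, Pi.add_apply, pd_add_left, par_add, ih hF, ih (pd_mem_multilinearFn hF _)]
    abel

lemma br_smul_right (hF : F ∈ multilinearFn R P) (c : ℝ) : br F (c • G) = c • br F G := by
  funext l
  induction l generalizing F G with
  | nil => simp only [br, Pi.smul_apply, par_smul, map_smul_cons hF, smul_add, smul_sub]
  | cons f l ih =>
    simp only [br, Pi.smul_apply, pd_smul_left, par_smul, ih hF,
      ih (pd_mem_multilinearFn hF _), smul_add]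

lemma br_mem_multilinearFn (hF : F ∈ multilinearFn R P) (hG : G ∈ multilinearFn R P) :
    br F G ∈ multilinearFn R P := by
  intro l₁ l₂ c f g
  induction l₁ generalizing F G with
  | nil =>
    have hG' := par_mem_multilinearFn hG
    simp only [List.nil_append, br, ev_add, ev_smul, od_add, od_smul, pd_add_right hF,
      pd_add_right hG, pd_smul_right hF, pd_smul_right hG, br_add_left hG, br_add_left hG',
      br_smul_left hG, br_smul_left hG', br_add_right hF, br_smul_right hF, Pi.add_apply,
      Pi.smul_apply]
    module
  | cons h l₁ ih =>
    simp only [List.cons_append, br, ih hF (pd_mem_multilinearFn hG _),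
      ih (pd_mem_multilinearFn hF _) hG,
      ih (pd_mem_multilinearFn hF _) (par_mem_multilinearFn hG)]
    module

lemma mul_add_left : Fn.mul (F + F') G = Fn.mul F G + Fn.mul F' G := by
  funext l
  induction l generalizing F F' G with
  | nil => simp only [Fn.mul, Pi.add_apply, add_mul]
  | cons f l ih =>
    simp only [Fn.mul, Pi.add_apply, pd_add_left, ih]
    abel

lemma mul_smul_left (c : ℝ) : Fn.mul (c • F) G = c • Fn.mul F G := by
  funext l
  induction l generalizing F G with
  | nil => simp only [Fn.mul, Pi.smul_apply, smul_mul_assoc]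
  | cons f l ih => simp only [Fn.mul, Pi.smul_apply, pd_smul_left, ih, smul_add]

lemma mul_add_right : Fn.mul F (G + G') = Fn.mul F G + Fn.mul F G' := by
  funext l
  induction l generalizing F G G' with
  | nil => simp only [Fn.mul, Pi.add_apply, mul_add]
  | cons f l ih =>
    simp only [Fn.mul, Pi.add_apply, pd_add_left, par_add, ih]
    abel

lemma mul_smul_right (c : ℝ) : Fn.mul F (c • G) = c • Fn.mul F G := by
  funext l
  induction l generalizing F G with
  | nil => simp only [Fn.mul, Pi.smul_apply, mul_smul_comm]
  | cons f l ih => simp only [Fn.mul, Pi.smul_apply, pd_smul_left, par_smul, ih, smul_add]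

lemma mul_mem_multilinearFn (hF : F ∈ multilinearFn R P) (hG : G ∈ multilinearFn R P) :
    Fn.mul F G ∈ multilinearFn R P := by
  intro l₁ l₂ c f g
  induction l₁ generalizing F G with
  | nil =>
    simp only [List.nil_append, Fn.mul, ev_add, ev_smul, od_add, od_smul, pd_add_right hF,
      pd_add_right hG, pd_smul_right hF, pd_smul_right hG, mul_add_left, mul_add_right,
      mul_smul_left, mul_smul_right, Pi.add_apply, Pi.smul_apply]
    module
  | cons h l₁ ih =>
    simp only [List.cons_append, Fn.mul, ih hF (pd_mem_multilinearFn hG _),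
      ih (pd_mem_multilinearFn hF _) hG,
      ih (pd_mem_multilinearFn hF _) (par_mem_multilinearFn hG)]
    module

lemma par_br : par (br F G) = br (par F) (par G) := by
  funext l
  induction l generalizing F G with
  | nil =>
    simp [par, br, parity_sub, parity_add, ev_parity, od_parity]
  | cons f l ih =>
    have e (F G : Fn R P) : parity (br F G (l.map parity)) = br (par F) (par G) l := ih
    simp only [par_pd, br, parity_add, e, par, List.map_cons, ev_parity, od_parity, par_par]
    simp only [parity_parity]

lemma par_mul : par (Fn.mul F G) = Fn.mul (par F) (par G) := by
  funext l
  induction l generalizing F G with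
  | nil => simp [par, Fn.mul]
  | cons f l ih =>
    have e (F G : Fn R P) : parity (Fn.mul F G (l.map parity)) = Fn.mul (par F) (par G) l := ih
    simp only [par_pd, Fn.mul, parity_add, e, par, List.map_cons, ev_parity, od_parity, par_par]
    simp only [parity_parity]

end Multilinear

end

section

variable {R P : Type*} [CommRing R] [Algebra ℝ R] [AddCommGroup P] [Module R P]

/-! ### The bracket as a bilinear map on multilinear functions -/

/-- The type of multilinear functions. -/
def MFn (R P : Type*) [CommRing R] [Algebra ℝ R] [AddCommGroup P] [Module R P] : Type _ :=
  multilinearFn R P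

instance : AddCommGroup (MFn R P) := inferInstanceAs (AddCommGroup (multilinearFn R P))

instance : Module ℝ (MFn R P) := inferInstanceAs (Module ℝ (multilinearFn R P))

/-- The restriction of a function to the zero section. -/
def nilₗ (F : MFn R P) : Form R P := F.1 []

/-- `pd` on multilinear functions. -/
def pdₗ (F : MFn R P) (f : Form R P) : MFn R P := ⟨pd F.1 f, pd_mem_multilinearFn F.2 f⟩

/-- `br` on multilinear functions. -/
def brₗ (F G : MFn R P) : MFn R P := ⟨br F.1 G.1, br_mem_multilinearFn F.2 G.2⟩

/-- `mul` on multilinear functions. -/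
def mulₗ (F G : MFn R P) : MFn R P := ⟨Fn.mul F.1 G.1, mul_mem_multilinearFn F.2 G.2⟩

/-- `par` on multilinear functions. -/
def parₗ (F : MFn R P) : MFn R P := ⟨par F.1, par_mem_multilinearFn F.2⟩

section Linearity

variable (F F' G G' : MFn R P) (f g : Form R P) (c : ℝ)

lemma nilₗ_add : nilₗ (F + G) = nilₗ F + nilₗ G := rfl

lemma nilₗ_smul : nilₗ (c • F) = c • nilₗ F := rfl

lemma pdₗ_add_left : pdₗ (F + G) f = pdₗ F f + pdₗ G f := rfl

lemma pdₗ_smul_left : pdₗ (c • F) f = c • pdₗ F f := rfl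

lemma pdₗ_add_right : pdₗ F (f + g) = pdₗ F f + pdₗ F g := Subtype.ext (pd_add_right F.2 f g)

lemma pdₗ_smul_right : pdₗ F (c • f) = c • pdₗ F f := Subtype.ext (pd_smul_right F.2 c f)

lemma parₗ_smul : parₗ (c • F) = c • parₗ F := Subtype.ext (par_smul c)

lemma brₗ_add_left : brₗ (F + F') G = brₗ F G + brₗ F' G := Subtype.ext (br_add_left G.2)

lemma brₗ_add_right : brₗ F (G + G') = brₗ F G + brₗ F G' := Subtype.ext (br_add_right F.2)

lemma brₗ_smul_left : brₗ (c • F) G = c • brₗ F G := Subtype.ext (br_smul_left G.2 c)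

lemma brₗ_smul_right : brₗ F (c • G) = c • brₗ F G := Subtype.ext (br_smul_right F.2 c)

lemma mulₗ_add_left : mulₗ (F + F') G = mulₗ F G + mulₗ F' G := Subtype.ext mul_add_left

lemma mulₗ_add_right : mulₗ F (G + G') = mulₗ F G + mulₗ F G' := Subtype.ext mul_add_right

lemma mulₗ_smul_left : mulₗ (c • F) G = c • mulₗ F G := Subtype.ext (mul_smul_left c)

lemma mulₗ_smul_right : mulₗ F (c • G) = c • mulₗ F G := Subtype.ext (mul_smul_right c)

lemma nilₗ_sub : nilₗ (F - G) = nilₗ F - nilₗ G := rfl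

lemma pdₗ_sub_left : pdₗ (F - G) f = pdₗ F f - pdₗ G f := rfl

lemma pdₗ_neg_right : pdₗ F (-f) = -pdₗ F f := by
  simpa only [neg_one_smul] using pdₗ_smul_right F f (-1)

lemma pdₗ_zero_right : pdₗ F 0 = 0 := Subtype.ext (pd_zero_right F.2)

lemma pdₗ_sub_right : pdₗ F (f - g) = pdₗ F f - pdₗ F g := by
  rw [sub_eq_add_neg, pdₗ_add_right, pdₗ_neg_right, sub_eq_add_neg]

lemma brₗ_neg_right : brₗ F (-G) = -brₗ F G := by
  simpa only [neg_one_smul] using brₗ_smul_right F G (-1)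

lemma brₗ_zero_left : brₗ 0 G = 0 := by
  simpa only [zero_smul] using brₗ_smul_left 0 G 0

lemma brₗ_zero_right : brₗ F 0 = 0 := by
  simpa only [zero_smul] using brₗ_smul_right F 0 0

lemma mulₗ_zero_left : mulₗ 0 G = 0 := by
  simpa only [zero_smul] using mulₗ_smul_left 0 G 0

end Linearity

/-- `F` is homogeneous of parity `p`. -/
def HasPar (p : ℕ) (F : MFn R P) : Prop := parₗ F = (-1 : ℝ) ^ p • F

/-! ### Antisymmetry, the Jacobi identity and the Poisson rule. -/

section Bilinear

variable {p q r d : ℕ} {F G H K : MFn R P} {f g : Form R P}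

lemma HasPar.pd (hF : HasPar p F) (hf : HasParity d f) : HasPar (p + d) (pdₗ F f) := by
  have h : parₗ (pdₗ F f) = pdₗ (parₗ F) (parity f) := Subtype.ext (par_pd f)
  unfold HasPar HasParity at *
  rw [h, hF, hf, pdₗ_smul_left, pdₗ_smul_right, smul_smul, pow_add]

lemma HasPar.br (hF : HasPar p F) (hG : HasPar q G) : HasPar (p + q) (brₗ F G) := by
  have h : parₗ (brₗ F G) = brₗ (parₗ F) (parₗ G) := Subtype.ext par_br
  unfold HasPar at *
  rw [h, hF, hG, brₗ_smul_left, brₗ_smul_right, smul_smul, pow_add]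

lemma HasPar.mul (hF : HasPar p F) (hG : HasPar q G) : HasPar (p + q) (mulₗ F G) := by
  have h : parₗ (mulₗ F G) = mulₗ (parₗ F) (parₗ G) := Subtype.ext par_mul
  unfold HasPar at *
  rw [h, hF, hG, mulₗ_smul_left, mulₗ_smul_right, smul_smul, pow_add]

lemma HasPar.nil (hF : HasPar p F) : HasParity p (nilₗ F) := by
  exact congrArg nilₗ hF

lemma nilₗ_brₗ (hF : HasPar p F) (hG : HasPar q G) :
    nilₗ (brₗ F G) = nilₗ (pdₗ F (nilₗ G)) - (-1 : ℝ) ^ (p * q) • nilₗ (pdₗ G (nilₗ F)) := by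
  have h : nilₗ (brₗ F G) = nilₗ (pdₗ F (nilₗ G)) -
    (nilₗ (pdₗ G (ev (nilₗ F))) + nilₗ (pdₗ (parₗ G) (od (nilₗ F)))) := rfl
  rw [h, pow_mul]
  rcases hF.nil.ev_od with ⟨h1, h2, h3⟩ | ⟨h1, h2, h3⟩
  · rw [h1, h2, h3, pdₗ_zero_right, one_pow, one_smul]
    exact congrArg _ (add_zero _)
  · rw [h1, h2, h3, pdₗ_zero_right, hG]
    exact congrArg _ (zero_add _)

lemma pdₗ_brₗ (hG : HasPar q G) (hf : HasParity d f) :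
    pdₗ (brₗ F G) f = brₗ F (pdₗ G f) + (-1 : ℝ) ^ (q * d) • brₗ (pdₗ F f) G := by
  have h : pdₗ (brₗ F G) f = brₗ F (pdₗ G f) +
    brₗ (pdₗ F (ev f)) G + brₗ (pdₗ F (od f)) (parₗ G) := rfl
  have h0 (K : MFn R P) : brₗ (pdₗ F 0) K = 0 := by rw [pdₗ_zero_right, brₗ_zero_left]
  rw [h, mul_comm, pow_mul]
  rcases hf.ev_od with ⟨h1, h2, h3⟩ | ⟨h1, h2, h3⟩
  · rw [h1, h2, h3, h0, one_pow, one_smul, add_zero]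
  · rw [h1, h2, h3, h0, hG, add_zero, brₗ_smul_right]

lemma pdₗ_mulₗ (hG : HasPar q G) (hf : HasParity d f) :
    pdₗ (mulₗ F G) f = mulₗ F (pdₗ G f) + (-1 : ℝ) ^ (q * d) • mulₗ (pdₗ F f) G := by
  have h : pdₗ (mulₗ F G) f = mulₗ F (pdₗ G f) +
    mulₗ (pdₗ F (ev f)) G + mulₗ (pdₗ F (od f)) (parₗ G) := rfl
  have h0 (K : MFn R P) : mulₗ (pdₗ F 0) K = 0 := by rw [pdₗ_zero_right, mulₗ_zero_left]
  rw [h, mul_comm, pow_mul]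
  rcases hf.ev_od with ⟨h1, h2, h3⟩ | ⟨h1, h2, h3⟩
  · rw [h1, h2, h3, h0, one_pow, one_smul, add_zero]
  · rw [h1, h2, h3, h0, hG, add_zero, mulₗ_smul_right]

lemma nilₗ_mulₗ : nilₗ (mulₗ F G) = nilₗ F * nilₗ G := rfl

/-- A class of functions that vanish on the zero section, and whose brackets with forms are
combinations of functions in the class, consists of zero. -/
lemma eq_zero_of_pd_mem_span (S : Set (MFn R P)) (h₀ : ∀ K ∈ S, nilₗ K = 0)
    (h₁ : ∀ K ∈ S, ∀ (d : ℕ) (f : Form R P), HasParity d f → pdₗ K f ∈ Submodule.span ℝ S)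
    (hK : K ∈ S) : K = 0 := by
  apply Subtype.ext
  funext l
  induction l generalizing K with
  | nil => exact h₀ K hK
  | cons f l ih =>
    -- Homogeneous forms suffice, since the first argument is the sum of its even and odd parts and
    -- `K` is additive in it.
    have key : ∀ (d : ℕ) (g : Form R P), HasParity d g → K.1 (g :: l) = 0 := by
      intro d g hg
      have : ∀ L ∈ Submodule.span ℝ S, L.1 l = 0 := by
        intro L hL
        induction hL using Submodule.span_induction with
        | mem x hx => exact ih hx
        | zero => rfl
        | add x y _ _ hx hy =>
          change x.1 l + y.1 l = 0
          rw [hx, hy, add_zero]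
        | smul c x _ hx =>
          change c • x.1 l = 0
          rw [hx, smul_zero]
      exact this _ (h₁ K hK d g hg)
    rw [← ev_add_od f, map_add_cons K.2, key 0 _ (hasParity_ev f), key 1 _ (hasParity_od f)]
    exact add_zero _

/-- On the zero section the formula of `nilₗ_brₗ` is visibly antisymmetric. Bracketing the defect of
`(F, G)` with `f` gives the defects of `(F, {G, f})` and `({F, f}, G)`, so all defects vanish
together. -/
lemma brₗ_antisymm (hF : HasPar p F) (hG : HasPar q G) :
    brₗ F G = -((-1 : ℝ) ^ (p * q) • brₗ G F) := by
  rw [eq_neg_iff_add_eq_zero]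
  apply eq_zero_of_pd_mem_span {K | ∃ (p q : ℕ) (F G : MFn R P), HasPar p F ∧ HasPar q G ∧
    K = brₗ F G + (-1 : ℝ) ^ (p * q) • brₗ G F}
  · rintro _ ⟨p, q, F, G, hF, hG, rfl⟩
    rw [nilₗ_add, nilₗ_smul, nilₗ_brₗ hF hG, nilₗ_brₗ hG hF, mul_comm q p]
    rcases neg_one_pow_eq_or ℝ (p * q) with h | h <;> rw [h] <;> module
  · rintro _ ⟨p, q, F, G, hF, hG, rfl⟩ d f hf
    have e₁ : (-1 : ℝ) ^ (p * (q + d)) = (-1) ^ (p * q) * (-1) ^ (p * d) := by ring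
    have e₂ : (-1 : ℝ) ^ ((p + d) * q) = (-1) ^ (p * q) * (-1) ^ (q * d) := by ring
    have h : pdₗ (brₗ F G + (-1 : ℝ) ^ (p * q) • brₗ G F) f =
        (brₗ F (pdₗ G f) + (-1 : ℝ) ^ (p * (q + d)) • brₗ (pdₗ G f) F) +
          (-1 : ℝ) ^ (q * d) • (brₗ (pdₗ F f) G + (-1 : ℝ) ^ ((p + d) * q) • brₗ G (pdₗ F f)) := by
      rw [pdₗ_add_left, pdₗ_smul_left, pdₗ_brₗ hG hf, pdₗ_brₗ hF hf, e₁, e₂]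
      rcases neg_one_pow_eq_or ℝ (q * d) with h | h <;> rw [h] <;> module
    rw [h]
    exact add_mem (Submodule.subset_span ⟨_, _, _, _, hF, hG.pd hf, rfl⟩)
      (Submodule.smul_mem _ _ (Submodule.subset_span ⟨_, _, _, _, hF.pd hf, hG, rfl⟩))
  · exact ⟨p, q, F, G, hF, hG, rfl⟩

/-- Graded symmetry in the arguments. -/
def IsGradedSymmetric (F : MFn R P) : Prop :=
  ∀ (l₁ l₂ : List (Form R P)) (p q : ℕ) (f g : Form R P), HasParity p f → HasParity q g →
    F.1 (l₁ ++ f :: g :: l₂) = (-1 : ℝ) ^ (p * q) • F.1 (l₁ ++ g :: f :: l₂)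

lemma IsGradedSymmetric.pd (hF : IsGradedSymmetric F) (f : Form R P) :
    IsGradedSymmetric (pdₗ F f) := fun l₁ => hF (f :: l₁)

lemma IsGradedSymmetric.pd_pd (hF : IsGradedSymmetric F) (hf : HasParity p f) (hg : HasParity q g) :
    pdₗ (pdₗ F f) g = (-1 : ℝ) ^ (p * q) • pdₗ (pdₗ F g) f :=
  Subtype.ext (funext fun l => hF [] l p q f g hf hg)

/-- The Jacobi identity. -/
lemma brₗ_jacobi (hF : HasPar p F) (hG : HasPar q G) (hH : HasPar r H)
    (sF : IsGradedSymmetric F) (sG : IsGradedSymmetric G) (sH : IsGradedSymmetric H) :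
    brₗ F (brₗ G H) = brₗ (brₗ F G) H + (-1 : ℝ) ^ (p * q) • brₗ G (brₗ F H) := by
  rw [← sub_eq_zero]
  -- The class contains the Jacobi defects of all triples and all parities at once, because
  -- bracketing with a form changes both the entries and their parities.
  apply eq_zero_of_pd_mem_span {K | ∃ (p q r : ℕ) (F G H : MFn R P),
    HasPar p F ∧ HasPar q G ∧ HasPar r H ∧ IsGradedSymmetric F ∧ IsGradedSymmetric G ∧
    IsGradedSymmetric H ∧
    K = brₗ F (brₗ G H) - (brₗ (brₗ F G) H + (-1 : ℝ) ^ (p * q) • brₗ G (brₗ F H))}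
  · rintro _ ⟨p, q, r, F, G, H, hF, hG, hH, sF, sG, sH, rfl⟩
    rw [nilₗ_sub, nilₗ_add, nilₗ_smul, nilₗ_brₗ hF (hG.br hH), nilₗ_brₗ (hF.br hG) hH,
      nilₗ_brₗ hG (hF.br hH), nilₗ_brₗ hG hH, nilₗ_brₗ hF hG, nilₗ_brₗ hF hH,
      pdₗ_brₗ hH hF.nil, pdₗ_brₗ hG hH.nil, pdₗ_brₗ hH hG.nil]
    simp only [pdₗ_sub_right, pdₗ_smul_right, nilₗ_sub, nilₗ_add, nilₗ_smul]
    -- The second order terms, in which one function is bracketed with the restrictions of the other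
    -- two, cancel only after these two arguments are exchanged. Graded symmetry enters here.
    rw [nilₗ_brₗ hG (hH.pd hF.nil), nilₗ_brₗ (hG.pd hF.nil) hH, nilₗ_brₗ hF (hG.pd hH.nil),
      nilₗ_brₗ (hF.pd hH.nil) hG, nilₗ_brₗ hF (hH.pd hG.nil), nilₗ_brₗ (hF.pd hG.nil) hH,
      sF.pd_pd hH.nil hG.nil, sG.pd_pd hH.nil hF.nil, sH.pd_pd hG.nil hF.nil]
    have e₁ : (-1 : ℝ) ^ (p * (q + r)) = (-1) ^ (p * q) * (-1) ^ (p * r) := by ring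
    have e₂ : (-1 : ℝ) ^ ((p + q) * r) = (-1) ^ (p * r) * (-1) ^ (q * r) := by ring
    have e₃ : (-1 : ℝ) ^ (q * (p + r)) = (-1) ^ (p * q) * (-1) ^ (q * r) := by ring
    have e₄ : (-1 : ℝ) ^ (q * (r + p)) = (-1) ^ (p * q) * (-1) ^ (q * r) := by ring
    have e₅ : (-1 : ℝ) ^ ((q + p) * r) = (-1) ^ (p * r) * (-1) ^ (q * r) := by ring
    have e₆ : (-1 : ℝ) ^ ((p + r) * q) = (-1) ^ (p * q) * (-1) ^ (q * r) := by ring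
    have e₇ : (-1 : ℝ) ^ (p * (r + q)) = (-1) ^ (p * q) * (-1) ^ (p * r) := by ring
    have e₈ : (-1 : ℝ) ^ (r * p) = (-1) ^ (p * r) := by ring
    have e₉ : (-1 : ℝ) ^ (r * q) = (-1) ^ (q * r) := by ring
    have e₁₀ : (-1 : ℝ) ^ (q * p) = (-1) ^ (p * q) := by ring
    rw [e₁, e₂, e₃, e₄, e₅, e₆, e₇, e₈, e₉, e₁₀]
    simp only [nilₗ_smul]
    rcases neg_one_pow_eq_or ℝ (p * q) with h1 | h1 <;>
    rcases neg_one_pow_eq_or ℝ (p * r) with h2 | h2 <;>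
    rcases neg_one_pow_eq_or ℝ (q * r) with h3 | h3 <;> rw [h1, h2, h3] <;> module
  · rintro _ ⟨p, q, r, F, G, H, hF, hG, hH, sF, sG, sH, rfl⟩ d f hf
    -- The form `f` lands on `H`, on `G` or on `F`, and each case is again a Jacobi defect up to a
    -- sign.
    have h : pdₗ (brₗ F (brₗ G H) - (brₗ (brₗ F G) H + (-1 : ℝ) ^ (p * q) • brₗ G (brₗ F H))) f =
        (brₗ F (brₗ G (pdₗ H f)) - (brₗ (brₗ F G) (pdₗ H f) +
          (-1 : ℝ) ^ (p * q) • brₗ G (brₗ F (pdₗ H f)))) +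
        (-1 : ℝ) ^ (r * d) • (brₗ F (brₗ (pdₗ G f) H) - (brₗ (brₗ F (pdₗ G f)) H +
          (-1 : ℝ) ^ (p * (q + d)) • brₗ (pdₗ G f) (brₗ F H))) +
        (-1 : ℝ) ^ ((q + r) * d) • (brₗ (pdₗ F f) (brₗ G H) - (brₗ (brₗ (pdₗ F f) G) H +
          (-1 : ℝ) ^ ((p + d) * q) • brₗ G (brₗ (pdₗ F f) H))) := by
      have e₁ : (-1 : ℝ) ^ (p * (q + d)) = (-1) ^ (p * q) * (-1) ^ (p * d) := by ring
      have e₂ : (-1 : ℝ) ^ ((p + d) * q) = (-1) ^ (p * q) * (-1) ^ (q * d) := by ring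
      have e₃ : (-1 : ℝ) ^ ((q + r) * d) = (-1) ^ (q * d) * (-1) ^ (r * d) := by ring
      have e₄ : (-1 : ℝ) ^ ((p + r) * d) = (-1) ^ (p * d) * (-1) ^ (r * d) := by ring
      rw [pdₗ_sub_left, pdₗ_add_left, pdₗ_smul_left, pdₗ_brₗ (hG.br hH) hf, pdₗ_brₗ hH hf,
        pdₗ_brₗ hH hf, pdₗ_brₗ (hF.br hH) hf, pdₗ_brₗ hG hf, pdₗ_brₗ hH hf, e₁, e₂, e₃, e₄]
      simp only [brₗ_add_left, brₗ_add_right, brₗ_smul_left, brₗ_smul_right]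
      rcases neg_one_pow_eq_or ℝ (p * q) with h1 | h1 <;>
      rcases neg_one_pow_eq_or ℝ (q * d) with h2 | h2 <;> rw [h1, h2] <;> module
    rw [h]
    exact add_mem (add_mem
      (Submodule.subset_span ⟨_, _, _, _, _, _, hF, hG, hH.pd hf, sF, sG, sH.pd f, rfl⟩)
      (Submodule.smul_mem _ _
        (Submodule.subset_span ⟨_, _, _, _, _, _, hF, hG.pd hf, hH, sF, sG.pd f, sH, rfl⟩)))
      (Submodule.smul_mem _ _
        (Submodule.subset_span ⟨_, _, _, _, _, _, hF.pd hf, hG, hH, sF.pd f, sG, sH, rfl⟩))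
  · exact ⟨p, q, r, F, G, H, hF, hG, hH, sF, sG, sH, rfl⟩

/-- `F` is a graded derivation in its last argument. -/
def IsGradedDerivation (F : MFn R P) : Prop :=
  ∀ (l₁ : List (Form R P)) (f g : Form R P), F.1 (l₁ ++ [f * g]) =
    F.1 (l₁ ++ [f]) * g + ev f * F.1 (l₁ ++ [g]) + od f * parity (F.1 (l₁ ++ [parity g]))

lemma IsGradedDerivation.pd (hF : IsGradedDerivation F) (f : Form R P) :
    IsGradedDerivation (pdₗ F f) := fun l₁ => hF (f :: l₁)

lemma IsGradedDerivation.nil_pd_mul (dF : IsGradedDerivation F) (hF : HasPar p F)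
    (hf : HasParity d f) :
    nilₗ (pdₗ F (f * g)) = nilₗ (pdₗ F f) * g + (-1 : ℝ) ^ (p * d) • (f * nilₗ (pdₗ F g)) := by
  have h : nilₗ (pdₗ F (f * g)) = nilₗ (pdₗ F f) * g + ev f * nilₗ (pdₗ F g) +
    od f * nilₗ (pdₗ (parₗ F) g) := dF [] f g
  rw [h, mul_comm p d, pow_mul]
  rcases hf.ev_od with ⟨h1, h2, h3⟩ | ⟨h1, h2, h3⟩
  · rw [h1, h2, h3, zero_mul, add_zero, one_pow, one_smul]
  · rw [h1, h2, h3, zero_mul, add_zero, hF, pdₗ_smul_left, nilₗ_smul, mul_smul_comm]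

/-- The Poisson rule. -/
lemma brₗ_mulₗ (hH : HasPar r H) (hF : HasPar p F) (hG : HasPar q G) (dH : IsGradedDerivation H) :
    brₗ H (mulₗ F G) = mulₗ (brₗ H F) G + (-1 : ℝ) ^ (r * p) • mulₗ F (brₗ H G) := by
  rw [← sub_eq_zero]
  apply eq_zero_of_pd_mem_span {K | ∃ (p q r : ℕ) (F G H : MFn R P),
    HasPar p F ∧ HasPar q G ∧ HasPar r H ∧ IsGradedDerivation H ∧
    K = brₗ H (mulₗ F G) - (mulₗ (brₗ H F) G + (-1 : ℝ) ^ (r * p) • mulₗ F (brₗ H G))}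
  · rintro _ ⟨p, q, r, F, G, H, hF, hG, hH, dH, rfl⟩
    -- On the zero section the rule is the Leibniz rule of `H` on the product of the restrictions of
    -- `F` and `G`, together with the bracket of `mulₗ F G` with the restriction of `H`.
    rw [nilₗ_sub, nilₗ_add, nilₗ_smul, nilₗ_brₗ hH (hF.mul hG), nilₗ_mulₗ, nilₗ_mulₗ, nilₗ_mulₗ,
      nilₗ_brₗ hH hF, nilₗ_brₗ hH hG, dH.nil_pd_mul hH hF.nil, pdₗ_mulₗ hG hH.nil, nilₗ_add,
      nilₗ_smul, nilₗ_mulₗ, nilₗ_mulₗ]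
    have e₁ : (-1 : ℝ) ^ (r * (p + q)) = (-1) ^ (r * p) * (-1) ^ (r * q) := by ring
    have e₂ : (-1 : ℝ) ^ (q * r) = (-1) ^ (r * q) := by ring
    rw [e₁, e₂, sub_mul, mul_sub, mul_smul_comm, smul_mul_assoc]
    rcases neg_one_pow_eq_or ℝ (r * q) with h2 | h2 <;> rw [h2] <;> module
  · rintro _ ⟨p, q, r, F, G, H, hF, hG, hH, dH, rfl⟩ d f hf
    have h : pdₗ (brₗ H (mulₗ F G) -
          (mulₗ (brₗ H F) G + (-1 : ℝ) ^ (r * p) • mulₗ F (brₗ H G))) f =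
        (brₗ H (mulₗ F (pdₗ G f)) - (mulₗ (brₗ H F) (pdₗ G f) +
          (-1 : ℝ) ^ (r * p) • mulₗ F (brₗ H (pdₗ G f)))) +
        (-1 : ℝ) ^ (q * d) • (brₗ H (mulₗ (pdₗ F f) G) - (mulₗ (brₗ H (pdₗ F f)) G +
          (-1 : ℝ) ^ (r * (p + d)) • mulₗ (pdₗ F f) (brₗ H G))) +
        (-1 : ℝ) ^ ((p + q) * d) • (brₗ (pdₗ H f) (mulₗ F G) - (mulₗ (brₗ (pdₗ H f) F) G +
          (-1 : ℝ) ^ ((r + d) * p) • mulₗ F (brₗ (pdₗ H f) G))) := by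
      have e₁ : (-1 : ℝ) ^ (r * (p + d)) = (-1) ^ (r * p) * (-1) ^ (r * d) := by ring
      have e₂ : (-1 : ℝ) ^ ((r + d) * p) = (-1) ^ (r * p) * (-1) ^ (p * d) := by ring
      have e₃ : (-1 : ℝ) ^ ((p + q) * d) = (-1) ^ (p * d) * (-1) ^ (q * d) := by ring
      have e₄ : (-1 : ℝ) ^ ((r + q) * d) = (-1) ^ (r * d) * (-1) ^ (q * d) := by ring
      rw [pdₗ_sub_left, pdₗ_add_left, pdₗ_smul_left, pdₗ_brₗ (hF.mul hG) hf, pdₗ_mulₗ hG hf,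
        pdₗ_mulₗ hG hf, pdₗ_mulₗ (hH.br hG) hf, pdₗ_brₗ hG hf, pdₗ_brₗ hF hf, e₁, e₂, e₃, e₄]
      simp only [brₗ_add_right, brₗ_smul_right, mulₗ_add_left,
        mulₗ_add_right, mulₗ_smul_left, mulₗ_smul_right]
      rcases neg_one_pow_eq_or ℝ (r * p) with h1 | h1 <;>
      rcases neg_one_pow_eq_or ℝ (p * d) with h2 | h2 <;> rw [h1, h2] <;> module
    rw [h]
    exact add_mem (add_mem
      (Submodule.subset_span ⟨_, _, _, _, _, _, hF, hG.pd hf, hH, dH, rfl⟩)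
      (Submodule.smul_mem _ _
        (Submodule.subset_span ⟨_, _, _, _, _, _, hF.pd hf, hG, hH, dH, rfl⟩)))
      (Submodule.smul_mem _ _
        (Submodule.subset_span ⟨_, _, _, _, _, _, hF, hG, hH.pd hf, dH.pd f, rfl⟩))
  · exact ⟨p, q, r, F, G, H, hF, hG, hH, dH, rfl⟩

end Bilinear

end

section

variable {R P : Type*} [CommRing R] [Algebra ℝ R] [AddCommGroup P] [Module R P]

/-! ### Multiderivations are closed under the bracket -/

section Multiderivation

variable {p q d : ℕ} {F G : MFn R P} {f g : Form R P}

lemma coe_cons (K : MFn R P) (f : Form R P) (l : List (Form R P)) :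
    K.1 (f :: l) = (pdₗ K f).1 l := rfl

lemma coe_add (K L : MFn R P) (l : List (Form R P)) : (K + L).1 l = K.1 l + L.1 l := rfl

lemma coe_smul (c : ℝ) (K : MFn R P) (l : List (Form R P)) : (c • K).1 l = c • K.1 l := rfl

/-- Peeling off the arguments in front reduces to an exchange of the first two. There, both orders
expand into the same four terms, and the signs match by the symmetry of `F` and of `G`. -/
lemma IsGradedSymmetric.br (sF : IsGradedSymmetric F) (sG : IsGradedSymmetric G)
    (hF : HasPar p F) (hG : HasPar q G) : IsGradedSymmetric (brₗ F G) := by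
  intro l₁ l₂ d e f g hf hg
  induction l₁ generalizing p q F G with
  | nil =>
    have h : pdₗ (pdₗ (brₗ F G) f) g = (-1 : ℝ) ^ (d * e) • pdₗ (pdₗ (brₗ F G) g) f := by
      rw [pdₗ_brₗ hG hf, pdₗ_brₗ hG hg, pdₗ_add_left, pdₗ_add_left, pdₗ_smul_left, pdₗ_smul_left,
        pdₗ_brₗ (hG.pd hf) hg, pdₗ_brₗ hG hg, pdₗ_brₗ (hG.pd hg) hf, pdₗ_brₗ hG hf,
        sG.pd_pd hf hg, sF.pd_pd hf hg, brₗ_smul_left, brₗ_smul_right]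
      have e₁ : (-1 : ℝ) ^ ((q + d) * e) = (-1) ^ (q * e) * (-1) ^ (d * e) := by ring
      have e₂ : (-1 : ℝ) ^ ((q + e) * d) = (-1) ^ (q * d) * (-1) ^ (d * e) := by ring
      rw [e₁, e₂]
      rcases neg_one_pow_eq_or ℝ (d * e) with h1 | h1 <;> rw [h1] <;> module
    exact congrArg (fun K : MFn R P => K.1 l₂) h
  | cons h l₁ ih =>
    have key : ∀ (c : ℕ) (h : Form R P), HasParity c h →
        (brₗ F G).1 (h :: (l₁ ++ f :: g :: l₂)) =
          (-1 : ℝ) ^ (d * e) • (brₗ F G).1 (h :: (l₁ ++ g :: f :: l₂)) := by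
      intro c h hh
      rw [coe_cons, coe_cons, pdₗ_brₗ hG hh, coe_add, coe_add, coe_smul, coe_smul,
        ih sF (sG.pd h) hF (hG.pd hh), ih (sF.pd h) sG (hF.pd hh) hG]
      module
    have hl := (brₗ F G).2
    rw [List.cons_append, List.cons_append, ← ev_add_od h, map_add_cons hl, map_add_cons hl,
      key 0 _ (hasParity_ev h), key 1 _ (hasParity_od h), smul_add]

/-- The first order part of the bracket is the graded commutator of the vector field parts, plus
each second order part contracted with the other function on the zero section. By symmetry `f` can
be kept in the last slot, so no sign depends on its parity. -/
lemma nilₗ_pdₗ_brₗ (hF : HasPar p F) (hG : HasPar q G) (sF : IsGradedSymmetric F)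
    (sG : IsGradedSymmetric G) (f : Form R P) :
    nilₗ (pdₗ (brₗ F G) f) = nilₗ (pdₗ F (nilₗ (pdₗ G f))) -
      (-1 : ℝ) ^ (p * q) • nilₗ (pdₗ G (nilₗ (pdₗ F f))) + nilₗ (pdₗ (pdₗ F (nilₗ G)) f) -
      (-1 : ℝ) ^ (p * q) • nilₗ (pdₗ (pdₗ G (nilₗ F)) f) := by
  have key : ∀ (d : ℕ) (f : Form R P), HasParity d f →
    nilₗ (pdₗ (brₗ F G) f) = nilₗ (pdₗ F (nilₗ (pdₗ G f))) -
      (-1 : ℝ) ^ (p * q) • nilₗ (pdₗ G (nilₗ (pdₗ F f))) + nilₗ (pdₗ (pdₗ F (nilₗ G)) f) -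
      (-1 : ℝ) ^ (p * q) • nilₗ (pdₗ (pdₗ G (nilₗ F)) f) := by
    intro d f hf
    rw [pdₗ_brₗ hG hf, nilₗ_add, nilₗ_smul, nilₗ_brₗ hF (hG.pd hf), nilₗ_brₗ (hF.pd hf) hG,
      sF.pd_pd hf hG.nil, sG.pd_pd hf hF.nil, nilₗ_smul, nilₗ_smul]
    have e₁ : (-1 : ℝ) ^ (p * (q + d)) = (-1) ^ (p * q) * (-1) ^ (p * d) := by ring
    have e₂ : (-1 : ℝ) ^ ((p + d) * q) = (-1) ^ (p * q) * (-1) ^ (q * d) := by ring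
    rw [e₁, e₂, mul_comm d q, mul_comm d p]
    rcases neg_one_pow_eq_or ℝ (q * d) with h1 | h1 <;>
    rcases neg_one_pow_eq_or ℝ (p * d) with h2 | h2 <;> rw [h1, h2] <;> module
  rw [← ev_add_od f]
  simp only [pdₗ_add_right, nilₗ_add]
  rw [key 0 _ (hasParity_ev f), key 1 _ (hasParity_od f)]
  module

/-- Passes from the signed Leibniz rule for homogeneous `f` to the sign-free form with `ev` and
`od`. -/
lemma HasPar.isGradedDerivation_nil (hF : HasPar p F)
    (h : ∀ (d : ℕ) (f g : Form R P), HasParity d f → nilₗ (pdₗ F (f * g)) =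
      nilₗ (pdₗ F f) * g + (-1 : ℝ) ^ (p * d) • (f * nilₗ (pdₗ F g))) (f g : Form R P) :
    F.1 [f * g] = F.1 [f] * g + ev f * F.1 [g] + od f * parity (F.1 [parity g]) := by
  have h1 : parity (F.1 [parity g]) = (-1 : ℝ) ^ p • F.1 [g] :=
    congrArg (fun K : MFn R P => K.1 [g]) hF
  have h2 : F.1 [f] = F.1 [ev f] + F.1 [od f] := by rw [← map_add_cons F.2, ev_add_od]
  have h3 : F.1 [f * g] = F.1 [ev f * g] + F.1 [od f * g] := by
    rw [← map_add_cons F.2, ← add_mul, ev_add_od]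
  have h4 : F.1 [ev f * g] = F.1 [ev f] * g + (-1 : ℝ) ^ (p * 0) • (ev f * F.1 [g]) :=
    h 0 _ g (hasParity_ev f)
  have h5 : F.1 [od f * g] = F.1 [od f] * g + (-1 : ℝ) ^ (p * 1) • (od f * F.1 [g]) :=
    h 1 _ g (hasParity_od f)
  rw [h3, h4, h5, h2, h1, add_mul, mul_smul_comm, mul_zero, mul_one, pow_zero, one_smul]
  abel

/-- After all arguments but the last are peeled off, `nilₗ_pdₗ_brₗ` applies: a graded commutator of
derivations is a derivation, since the cross terms cancel, and the two contracted second order parts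
are derivations in their remaining argument. -/
lemma IsGradedDerivation.br (dF : IsGradedDerivation F) (dG : IsGradedDerivation G)
    (sF : IsGradedSymmetric F) (sG : IsGradedSymmetric G)
    (hF : HasPar p F) (hG : HasPar q G) : IsGradedDerivation (brₗ F G) := by
  intro l₁ f g
  induction l₁ generalizing p q F G with
  | nil =>
    refine (hF.br hG).isGradedDerivation_nil ?_ f g
    intro d f g hf
    simp only [nilₗ_pdₗ_brₗ hF hG sF sG]
    rw [dF.nil_pd_mul hF hf, dG.nil_pd_mul hG hf, (dF.pd _).nil_pd_mul (hF.pd hG.nil) hf,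
      (dG.pd _).nil_pd_mul (hG.pd hF.nil) hf, pdₗ_add_right, pdₗ_add_right, pdₗ_smul_right,
      pdₗ_smul_right, nilₗ_add, nilₗ_add, nilₗ_smul, nilₗ_smul,
      dF.nil_pd_mul hF hf, dG.nil_pd_mul hG hf, dF.nil_pd_mul hF (hG.pd hf).nil,
      dG.nil_pd_mul hG (hF.pd hf).nil]
    have e₁ : (-1 : ℝ) ^ (p * (q + d)) = (-1) ^ (p * q) * (-1) ^ (p * d) := by ring
    have e₂ : (-1 : ℝ) ^ (q * (p + d)) = (-1) ^ (p * q) * (-1) ^ (q * d) := by ring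
    have e₃ : (-1 : ℝ) ^ ((p + q) * d) = (-1) ^ (p * d) * (-1) ^ (q * d) := by ring
    have e₄ : (-1 : ℝ) ^ ((q + p) * d) = (-1) ^ (p * d) * (-1) ^ (q * d) := by ring
    rw [e₁, e₂, e₃, e₄]
    simp only [sub_mul, mul_sub, add_mul, mul_add, mul_smul_comm, smul_mul_assoc]
    rcases neg_one_pow_eq_or ℝ (p * q) with h1 | h1 <;> rw [h1] <;> module
  | cons h l₁ ih =>
    have key : ∀ (c : ℕ) (h : Form R P), HasParity c h → (brₗ F G).1 (h :: (l₁ ++ [f * g])) =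
        (brₗ F G).1 (h :: (l₁ ++ [f])) * g + ev f * (brₗ F G).1 (h :: (l₁ ++ [g])) +
          od f * parity ((brₗ F G).1 (h :: (l₁ ++ [parity g]))) := by
      intro c h hh
      simp only [coe_cons _ h, pdₗ_brₗ hG hh, coe_add, coe_smul, parity_add, parity_smul]
      rw [ih dF (dG.pd h) sF (sG.pd h) hF (hG.pd hh), ih (dF.pd h) dG (sF.pd h) sG (hF.pd hh) hG]
      simp only [add_mul, mul_add, smul_add, mul_smul_comm, smul_mul_assoc]
      abel
    have hl := (brₗ F G).2
    rw [List.cons_append, List.cons_append, List.cons_append, List.cons_append, ← ev_add_od h]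
    simp only [map_add_cons hl, parity_add, key 0 _ (hasParity_ev h), key 1 _ (hasParity_od h),
      add_mul, mul_add]
    abel

/-- `F` takes exactly `k` arguments. -/
def HasArity (k : ℤ) (F : MFn R P) : Prop :=
  ∀ fs : List (Form R P), (fs.length : ℤ) ≠ k → F.1 fs = 0

lemma HasArity.pd {k : ℤ} (hF : HasArity k F) (f : Form R P) : HasArity (k - 1) (pdₗ F f) :=
  fun fs h => hF (f :: fs) (by simp only [List.length_cons]; push_cast; omega)

lemma HasArity.par {k : ℤ} (hF : HasArity k F) : HasArity k (parₗ F) := fun fs h => by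
  change parity (F.1 (fs.map parity)) = 0
  rw [hF _ (by simpa using h), parity_zero]

lemma HasArity.br {k k' : ℤ} (hF : HasArity k F) (hG : HasArity k' G) :
    HasArity (k + k' - 1) (brₗ F G) := by
  intro fs h
  induction fs generalizing F G k k' with
  | nil =>
    have key : ∀ {K L : MFn R P} {m n : ℤ} (φ : Form R P → Form R P), φ 0 = 0 → HasArity m K →
        HasArity n L → m + n ≠ 1 → K.1 [φ (L.1 [])] = 0 := by
      intro K L m n φ hφ hK hL hmn
      by_cases hn : n = 0
      · exact hK _ (by simp; omega)
      · rw [hL [] (by simpa using Ne.symm hn), hφ]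
        exact map_zero_cons K.2 []
    have h' : k + k' ≠ 1 := by simp at h; omega
    change F.1 [G.1 []] - (G.1 [ev (F.1 [])] + (parₗ G).1 [od (F.1 [])]) = 0
    rw [key (fun x => x) rfl hF hG h', key ev ev_zero hG hF (by omega),
      key od od_zero hG.par hF (by omega)]
    simp
  | cons f l ih =>
    change (brₗ F (pdₗ G f)).1 l + (brₗ (pdₗ F (ev f)) G).1 l +
      (brₗ (pdₗ F (od f)) (parₗ G)).1 l = 0
    have h' : (l.length : ℤ) ≠ k + k' - 1 - 1 := by
      simp only [List.length_cons] at h; push_cast at h; omega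
    rw [ih hF (hG.pd f) (by omega), ih (hF.pd _) hG (by omega), ih (hF.pd _) hG.par (by omega)]
    simp

/-- `F` raises the form degree by `d`. -/
def HasDegree (d : ℤ) (F : MFn R P) : Prop :=
  ∀ (fs : List (Form R P)) (a : List ℕ),
    List.Forall₂ (fun f n => f ∈ ⋀[R]^n (Module.Dual R P)) fs a → F.1 fs ∈ formDeg ((a.sum : ℤ) + d)

lemma HasDegree.pd {d : ℤ} (hF : HasDegree d F) {n : ℕ} (hf : f ∈ ⋀[R]^n (Module.Dual R P)) :
    HasDegree (d + n) (pdₗ F f) := fun fs a h => by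
  have := hF (f :: fs) (n :: a) (List.Forall₂.cons hf h)
  rw [List.sum_cons, Nat.cast_add] at this
  rw [show (a.sum : ℤ) + (d + n) = n + a.sum + d by ring]
  exact this

lemma HasDegree.par {d : ℤ} (hF : HasDegree d F) : HasDegree d (parₗ F) := fun fs a h => by
  refine parity_mem_formDeg (hF (fs.map parity) a ?_)
  rw [List.forall₂_map_left_iff]
  exact h.imp fun _ _ => parity_mem

lemma HasDegree.eval {d e : ℤ} (hF : HasDegree d F) (hf : f ∈ formDeg e) :
    F.1 [f] ∈ formDeg (e + d) := by
  rw [mem_formDeg_iff] at hf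
  rcases hf with rfl | ⟨he, hf⟩
  · rw [map_zero_cons F.2]
    exact Submodule.zero_mem _
  · have := hF [f] [e.toNat] (List.Forall₂.cons hf List.Forall₂.nil)
    simpa [he] using this

lemma ev_mem_formDeg {n : ℤ} (h : f ∈ formDeg n) : ev f ∈ formDeg n :=
  Submodule.smul_mem _ _ (Submodule.add_mem _ h (parity_mem_formDeg h))

lemma od_mem_formDeg {n : ℤ} (h : f ∈ formDeg n) : od f ∈ formDeg n :=
  Submodule.smul_mem _ _ (Submodule.sub_mem _ h (parity_mem_formDeg h))

lemma HasDegree.br {d e : ℤ} (hF : HasDegree d F) (hG : HasDegree e G) :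
    HasDegree (d + e) (brₗ F G) := by
  intro fs a h
  induction h generalizing F G d e with
  | nil =>
    have key : ∀ {K : MFn R P} {m : ℤ}, HasDegree m K → K.1 [] ∈ formDeg m := fun hK => by
      simpa using hK [] [] List.Forall₂.nil
    change F.1 [G.1 []] - (G.1 [ev (F.1 [])] + (parₗ G).1 [od (F.1 [])]) ∈ _
    have h1 := hF.eval (key hG)
    have h2 := hG.eval (ev_mem_formDeg (key hF))
    have h3 := hG.par.eval (od_mem_formDeg (key hF))
    rw [add_comm] at h1
    simp only [List.sum_nil, Nat.cast_zero, zero_add]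
    exact Submodule.sub_mem _ h1 (Submodule.add_mem _ h2 h3)
  | @cons f n l a hf h ih =>
    change (brₗ F (pdₗ G f)).1 l + (brₗ (pdₗ F (ev f)) G).1 l +
      (brₗ (pdₗ F (od f)) (parₗ G)).1 l ∈ _
    have h1 := ih hF (hG.pd hf)
    have h2 := ih (hF.pd (ev_mem hf)) hG
    have h3 := ih (hF.pd (od_mem hf)) hG.par
    rw [List.sum_cons, Nat.cast_add]
    rw [show (a.sum : ℤ) + (d + (e + n)) = n + a.sum + (d + e) by ring] at h1
    rw [show (a.sum : ℤ) + (d + n + e) = n + a.sum + (d + e) by ring] at h2 h3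
    exact Submodule.add_mem _ (Submodule.add_mem _ h1 h2) h3

/-- Parity acts on degree `n` by `(-1)^n`. The degrees of the arguments are counted once on the
arguments and once on the value, so they cancel and leave the sign of the shift `d`. -/
lemma HasDegree.hasPar {d : ℤ} (hF : HasDegree d F) (hp : Even (d + p)) : HasPar p F := by
  apply Subtype.ext
  funext l
  change (parₗ F).1 l = (-1 : ℝ) ^ p • F.1 l
  induction l generalizing F d p with
  | nil =>
    have h := hF [] [] List.Forall₂.nil
    simp only [List.sum_nil, Nat.cast_zero, zero_add] at h
    change parity (F.1 []) = _
    rw [mem_formDeg_iff] at h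
    rcases h with h | ⟨hd, h⟩
    · rw [h, parity_zero, smul_zero]
    · rw [hasParity_of_mem h]
      congr 1
      lift d to ℕ using hd
      have : Even (d + p) := by exact_mod_cast hp
      rw [Int.toNat_natCast]
      rw [Nat.even_add] at this
      by_cases hd : Even d
      · rw [hd.neg_one_pow, (this.1 hd).neg_one_pow]
      · rw [(Nat.not_even_iff_odd.1 hd).neg_one_pow,
          (Nat.not_even_iff_odd.1 (fun h => hd (this.2 h))).neg_one_pow]
  | cons f l ih =>
    induction f using form_induction with
    | zero => rw [map_zero_cons F.2, map_zero_cons (parₗ F).2, smul_zero]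
    | add f g hf hg => rw [map_add_cons F.2, map_add_cons (parₗ F).2, hf, hg, smul_add]
    | homogeneous n f hf =>
      have h1 : (parₗ F).1 (f :: l) = (parₗ (pdₗ F (parity f))).1 l := rfl
      have h2 : (parₗ (pdₗ F f)).1 l = (-1 : ℝ) ^ (p + n) • (pdₗ F f).1 l := by
        refine ih (hF.pd hf) ?_
        push_cast
        rw [show d + n + (p + n) = d + p + 2 * n by ring]
        exact hp.add (even_two_mul _)
      rw [h1, hasParity_of_mem hf, pdₗ_smul_right, parₗ_smul, coe_smul, h2, smul_smul, coe_cons]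
      congr 1
      rw [pow_add, mul_comm, mul_assoc, ← pow_add, ← two_mul, pow_mul]
      simp

/-- `F` is a graded symmetric `k`-derivation that raises the form degree by `l - k`. -/
structure IsMultiderivation (k l : ℤ) (F : MFn R P) : Prop where
  symm : IsGradedSymmetric F
  deriv : IsGradedDerivation F
  arity : HasArity k F
  degree : HasDegree (l - k) F

lemma IsMultiderivation.hasPar {k l : ℤ} (hF : IsMultiderivation k l F) (hp : Even (l + k + p)) :
    HasPar p F :=
  hF.degree.hasPar (by rw [show l - k + p = l + k + p + 2 * (-k) by ring]
                       exact hp.add (even_two_mul _))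

lemma IsMultiderivation.exists_hasPar {k l : ℤ} (hF : IsMultiderivation k l F) :
    ∃ p, HasPar p F := by
  refine ⟨(l + k).natAbs, hF.hasPar ?_⟩
  rw [Int.even_add, Int.even_coe_nat, Int.natAbs_even]

lemma IsMultiderivation.br {k l k' l' : ℤ} (hF : IsMultiderivation k l F)
    (hG : IsMultiderivation k' l' G) : IsMultiderivation (k + k' - 1) (l + l' - 1) (brₗ F G) := by
  obtain ⟨p, hp⟩ := hF.exists_hasPar
  obtain ⟨q, hq⟩ := hG.exists_hasPar
  refine ⟨hF.symm.br hG.symm hp hq, hF.deriv.br hG.deriv hF.symm hG.symm hp hq,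
    hF.arity.br hG.arity, ?_⟩
  have := hF.degree.br hG.degree
  rwa [show l - k + (l' - k') = l + l' - 1 - (k + k' - 1) by ring] at this

/-! ### Vanishing in negative bidegree, and the comparison with `bi`. -/

lemma IsGradedSymmetric.eval_eq_zero (sF : IsGradedSymmetric F) (hf : HasParity d f)
    (h : ∀ l, F.1 (f :: l) = 0) (l l₂ : List (Form R P)) : F.1 (l ++ f :: l₂) = 0 := by
  induction l using List.reverseRecOn generalizing l₂ with
  | nil => exact h l₂
  | append_singleton l g ih =>
    have := F.2 l (f :: l₂) 1 (ev g) (od g)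
    rw [one_smul, one_smul, ev_add_od, sF l l₂ _ _ _ _ (hasParity_ev g) hf,
      sF l l₂ _ _ _ _ (hasParity_od g) hf, ih, ih] at this
    simpa using this

/-- There are no functions of negative bidegree. -/
lemma IsMultiderivation.eq_zero {k l : ℤ} (hF : IsMultiderivation k l F) (h : k < 0 ∨ l < 0) :
    F = 0 := by
  by_cases hk : k < 0
  · exact Subtype.ext (funext fun fs => hF.arity fs (by omega))
  replace h : l < 0 := by omega
  obtain ⟨sF, dF, aF, gF⟩ := hF
  -- For `l < 0` the shift `m = l - k` lies below `-k`. This form of the bound survives the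
  -- induction on the arity: a bracket with a form of degree at most one lowers the arity by one and
  -- raises `m` by at most one.
  suffices H : ∀ (n : ℕ) (F : MFn R P) (m : ℤ), m < -n → IsGradedSymmetric F →
      IsGradedDerivation F → HasArity n F → HasDegree m F → F = 0 by
    lift k to ℕ using not_lt.1 hk
    exact H k F (l - k) (by omega) sF dF aF gF
  clear! F k l
  intro n
  induction n with
  | zero =>
    intro F m hm sF dF aF gF
    apply Subtype.ext
    funext fs
    match fs with
    | [] =>
      have := gF [] [] List.Forall₂.nil
      rw [mem_formDeg_iff] at this
      rcases this with h | ⟨h, -⟩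
      · exact h
      · simp at h; omega
    | f :: l => exact aF _ (by simp; omega)
  | succ n ih =>
    intro F m hm sF dF aF gF
    -- Functions and one-forms generate the algebra of forms. The induction hypothesis makes `F`
    -- vanish with such a form in first place, and symmetry moves it to the last place, where the
    -- Leibniz rule is available.
    have gen : ∀ (e : ℕ) (f : Form R P), f ∈ ⋀[R]^e (Module.Dual R P) → e ≤ 1 →
        ∀ l, F.1 (l ++ [f]) = 0 := by
      intro e f hf he l
      refine sF.eval_eq_zero (hasParity_of_mem hf) (fun l => ?_) l []
      have : pdₗ F f = 0 := by
        refine ih (pdₗ F f) (m + e) (by push_cast at hm; omega) (sF.pd f) (dF.pd f) ?_ (gF.pd hf)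
        have := aF.pd f
        push_cast at this
        simpa using this
      exact congrArg (fun K : MFn R P => K.1 l) this
    have gen' : ∀ (e : ℕ) (f : Form R P), f ∈ ⋀[R]^e (Module.Dual R P) → e ≤ 1 →
        ∀ l, F.1 (l ++ [f]) = 0 ∧ F.1 (l ++ [parity f]) = 0 := fun e f hf he l =>
      ⟨gen e f hf he l, gen e _ (parity_mem hf) he l⟩
    -- The parity transform is carried along because the Leibniz rule evaluates `F` at `parity g`.
    have all : ∀ f : Form R P, ∀ l, F.1 (l ++ [f]) = 0 ∧ F.1 (l ++ [parity f]) = 0 := by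
      intro f
      induction f using ExteriorAlgebra.induction with
      | algebraMap r =>
        refine gen' 0 _ ?_ (by omega)
        change _ ∈ LinearMap.range (ExteriorAlgebra.ι R) ^ 0
        rw [pow_zero]
        exact Submodule.algebraMap_mem r
      | ι x =>
        refine gen' 1 _ ?_ le_rfl
        change _ ∈ LinearMap.range (ExteriorAlgebra.ι R) ^ 1
        rw [pow_one]
        exact LinearMap.mem_range_self _ x
      | mul f g hf hg =>
        intro l
        rw [parity_mul, dF, dF, parity_parity, (hf l).1, (hf l).2, (hg l).1, (hg l).2]
        simp [parity_zero]
      | add f g hf hg =>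
        intro l
        have h1 := F.2 l [] 1 f g
        have h2 := F.2 l [] 1 (parity f) (parity g)
        rw [one_smul, one_smul, (hf l).1, (hg l).1] at h1
        rw [one_smul, one_smul, (hf l).2, (hg l).2] at h2
        rw [parity_add, h1, h2]
        simp
    apply Subtype.ext
    funext fs
    rcases List.eq_nil_or_concat' fs with rfl | ⟨l, f, rfl⟩
    · exact aF [] (by simp; omega)
    · exact (all f l).1

/-- A form of given parity may mix several degrees, so the sign rule for forms of pure degree has to
be extended by linearity. -/
lemma isGradedSymmetric_of_mem (h : ∀ (l₁ l₂ : List (Form R P)) (p q : ℕ) (f g : Form R P),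
      f ∈ ⋀[R]^p (Module.Dual R P) → g ∈ ⋀[R]^q (Module.Dual R P) →
      F.1 (l₁ ++ f :: g :: l₂) = (-1 : ℝ) ^ (p * q) • F.1 (l₁ ++ g :: f :: l₂)) :
    IsGradedSymmetric F := by
  have add (l₁ l₂ : List (Form R P)) (f g : Form R P) :
      F.1 (l₁ ++ (f + g) :: l₂) = F.1 (l₁ ++ f :: l₂) + F.1 (l₁ ++ g :: l₂) := by
    simpa using F.2 l₁ l₂ 1 f g
  have zero (l₁ l₂ : List (Form R P)) : F.1 (l₁ ++ 0 :: l₂) = 0 := by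
    simpa using F.2 l₁ l₂ 1 0 0
  have smul (l₁ l₂ : List (Form R P)) (c : ℝ) (f : Form R P) :
      F.1 (l₁ ++ (c • f) :: l₂) = c • F.1 (l₁ ++ f :: l₂) := by
    simpa [zero] using F.2 l₁ l₂ c f 0
  have add' (l₁ l₂ : List (Form R P)) (f g h : Form R P) :
      F.1 (l₁ ++ h :: (f + g) :: l₂) = F.1 (l₁ ++ h :: f :: l₂) + F.1 (l₁ ++ h :: g :: l₂) := by
    simpa using add (l₁ ++ [h]) l₂ f g
  have zero' (l₁ l₂ : List (Form R P)) (h : Form R P) : F.1 (l₁ ++ h :: 0 :: l₂) = 0 := by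
    simpa using zero (l₁ ++ [h]) l₂
  -- This form of the exchange rule contains no degrees and is additive in `f` and in `g`, so it
  -- need only be checked on forms of pure degree.
  have key (l₁ l₂ : List (Form R P)) (f g : Form R P) : F.1 (l₁ ++ f :: g :: l₂) =
      F.1 (l₁ ++ g :: ev f :: l₂) + F.1 (l₁ ++ parity g :: od f :: l₂) := by
    induction f using form_induction with
    | zero => simp [zero, zero']
    | add f f' hf hf' => rw [add, hf, hf', ev_add, od_add, add', add']; abel
    | homogeneous n f hf =>
      induction g using form_induction with
      | zero => simp [zero, zero', parity_zero]
      | add g g' hg hg' => rw [add', hg, hg', parity_add, add, add]; abel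
      | homogeneous m g hg =>
        rw [h l₁ l₂ n m f g hf hg, hasParity_of_mem hg, smul, pow_mul]
        rcases (hasParity_of_mem hf).ev_od with ⟨h1, h2, h3⟩ | ⟨h1, h2, h3⟩
        · simp [h1, h2, h3, zero']
        · simp [h1, h2, h3, zero']
  intro l₁ l₂ p q f g hf hg
  have hg' : parity g = (-1 : ℝ) ^ q • g := hg
  rw [key, hg', smul, pow_mul]
  rcases hf.ev_od with ⟨h1, h2, h3⟩ | ⟨h1, h2, h3⟩
  · simp [h1, h2, h3, zero']
  · simp [h1, h2, h3, zero']

lemma coe_mem_bi_iff {k l : ℕ} : F.1 ∈ bi k l ↔ IsMultiderivation k l F := by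
  constructor
  · rintro ⟨h1, -, h3, h4, h5⟩
    refine ⟨isGradedSymmetric_of_mem h3, h4, fun fs h => h1 fs (by exact_mod_cast h), ?_⟩
    intro fs a h
    have := h5 fs a h
    rwa [add_sub_assoc] at this
  · rintro ⟨h1, h2, h3, h4⟩
    refine ⟨fun fs h => h3 fs (by exact_mod_cast h), F.2, ?_, h2, ?_⟩
    · exact fun l₁ l₂ p q f g hf hg => h1 l₁ l₂ p q f g (hasParity_of_mem hf) (hasParity_of_mem hg)
    · intro fs a h
      rw [add_sub_assoc]
      exact h4 fs a h

lemma mem_multilinearFn_of_mem_bi {k l : ℕ} {F : Fn R P} (hF : F ∈ bi k l) :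
    F ∈ multilinearFn R P := hF.multilinear

end Multiderivation

end

section

/-! ### Exponentials of locally nilpotent operators -/

section Exp

open Finset

variable {V : Type*} [AddCommGroup V] [Module ℝ V] (X : Module.End ℝ V)

/-- The exponential series of `t X` at `v`. -/
def expSeries (t : ℝ) (v : V) : V := ∑ᶠ n : ℕ, (t ^ n / (n.factorial : ℝ)) • (X ^ n) v

variable {X} {u v : V} {N : ℕ}

lemma pow_apply_eq_zero (h : (X ^ N) v = 0) {n : ℕ} (hn : N ≤ n) : (X ^ n) v = 0 := by
  obtain ⟨m, rfl⟩ := Nat.exists_eq_add_of_le' hn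
  rw [pow_add, Module.End.mul_apply, h, map_zero]

lemma expSeries_eq_sum (h : (X ^ N) v = 0) (t : ℝ) :
    expSeries X t v = ∑ n ∈ range N, (t ^ n / (n.factorial : ℝ)) • (X ^ n) v := by
  refine finsum_eq_sum_of_support_subset _ fun n hn => ?_
  by_contra hn'
  simp only [coe_range, Set.mem_Iio, not_lt] at hn'
  exact hn (by simp only [pow_apply_eq_zero h hn', smul_zero])

lemma expSeries_mem {S : Submodule ℝ V} (hS : ∀ v ∈ S, X v ∈ S) (h : (X ^ N) v = 0) (hv : v ∈ S)
    (t : ℝ) : expSeries X t v ∈ S := by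
  rw [expSeries_eq_sum h]
  have key (n : ℕ) : (X ^ n) v ∈ S := by
    induction n with
    | zero => exact hv
    | succ n ih => rw [pow_succ']; exact hS _ ih
  exact S.sum_mem fun n _ => S.smul_mem _ (key n)

lemma expSeries_zero (v : V) : expSeries X 0 v = v := by
  rw [expSeries, finsum_eq_single _ 0 fun n hn => by simp [hn]]
  simp

lemma expSeries_add_right (hu : ∃ N, (X ^ N) u = 0) (hv : ∃ N, (X ^ N) v = 0) (t : ℝ) :
    expSeries X t (u + v) = expSeries X t u + expSeries X t v := by
  obtain ⟨M, hM⟩ := hu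
  obtain ⟨N, hN⟩ := hv
  have h1 := pow_apply_eq_zero hM (le_max_left M N)
  have h2 := pow_apply_eq_zero hN (le_max_right M N)
  have h3 : (X ^ max M N) (u + v) = 0 := by rw [map_add, h1, h2, add_zero]
  rw [expSeries_eq_sum h1, expSeries_eq_sum h2, expSeries_eq_sum h3, ← sum_add_distrib]
  simp only [map_add, smul_add]

lemma expSeries_smul (hv : ∃ N, (X ^ N) v = 0) (t c : ℝ) :
    expSeries X t (c • v) = c • expSeries X t v := by
  obtain ⟨N, hN⟩ := hv
  have h : (X ^ N) (c • v) = 0 := by rw [map_smul, hN, smul_zero]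
  rw [expSeries_eq_sum hN, expSeries_eq_sum h, smul_sum]
  simp only [map_smul, smul_comm c]

/-- Regroups the product of two terminating series by total degree: the antidiagonals below `N + N`
cover the box `N × N`, and the terms outside the box vanish. -/
lemma sum_range_sum_antidiagonal {g : ℕ → ℕ → V} (h : ∀ i j, N ≤ i ∨ N ≤ j → g i j = 0) :
    ∑ n ∈ range (N + N), ∑ p ∈ antidiagonal n, g p.1 p.2 =
      ∑ i ∈ range N, ∑ j ∈ range N, g i j := by
  rw [← sum_product' (f := g), ← sum_fiberwise_of_maps_to (s := range N ×ˢ range N)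
    (t := range (N + N)) (g := fun p => p.1 + p.2)]
  · refine sum_congr rfl fun n _ => ?_
    symm
    refine sum_subset (fun p hp => ?_) fun p hp hp' => ?_
    · simpa using (mem_filter.1 hp).2
    · apply h
      by_contra! H
      exact hp' (mem_filter.2 ⟨mem_product.2 ⟨mem_range.2 H.1, mem_range.2 H.2⟩,
        mem_antidiagonal.1 hp⟩)
  · intro p hp
    simp only [mem_product, mem_range] at hp ⊢
    omega

lemma pow_div_factorial_mul_choose (t : ℝ) (i j : ℕ) :
    t ^ (i + j) / ((i + j).factorial : ℝ) * ((i + j).choose i : ℝ) =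
      t ^ i / (i.factorial : ℝ) * (t ^ j / (j.factorial : ℝ)) := by
  have h : ((i + j).choose i : ℝ) * i.factorial * j.factorial = (i + j).factorial := by
    rw [Nat.choose_symm_add]
    exact_mod_cast Nat.add_choose_mul_factorial_mul_factorial i j
  have h1 : ((i + j).factorial : ℝ) ≠ 0 := by positivity
  field_simp
  rw [← h]
  ring

lemma expSeries_add (hv : ∃ N, (X ^ N) v = 0) (s t : ℝ) :
    expSeries X (s + t) v = expSeries X s (expSeries X t v) := by
  obtain ⟨N, hN⟩ := hv
  have h1 : (X ^ N) (expSeries X t v) = 0 := by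
    rw [expSeries_eq_sum hN, map_sum]
    refine sum_eq_zero fun n _ => ?_
    rw [map_smul, ← Module.End.mul_apply, ← pow_add, pow_apply_eq_zero hN (Nat.le_add_right _ _),
      smul_zero]
  have h2 : (X ^ (N + N)) v = 0 := pow_apply_eq_zero hN (Nat.le_add_right _ _)
  rw [expSeries_eq_sum h1, expSeries_eq_sum h2, expSeries_eq_sum hN]
  simp only [map_sum, smul_sum]
  rw [← sum_range_sum_antidiagonal (g := fun i j => (s ^ i / (i.factorial : ℝ)) •
    (X ^ i) ((t ^ j / (j.factorial : ℝ)) • (X ^ j) v))]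
  · refine sum_congr rfl fun n _ => ?_
    rw [(Commute.all s t).add_pow', sum_div, sum_smul]
    refine sum_congr rfl fun p hp => ?_
    obtain ⟨i, j⟩ := p
    obtain rfl : i + j = n := mem_antidiagonal.1 hp
    rw [map_smul, ← Module.End.mul_apply, ← pow_add, smul_smul]
    congr 1
    have := pow_div_factorial_mul_choose 1 i j
    simp only [one_pow] at this
    rw [nsmul_eq_mul]
    linear_combination s ^ i * t ^ j * this
  · intro i j hij
    rw [map_smul, ← Module.End.mul_apply, ← pow_add, pow_apply_eq_zero hN (by omega), smul_zero,
      smul_zero]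

variable {B : V →ₗ[ℝ] V →ₗ[ℝ] V} {S : Submodule ℝ V}

lemma pow_apply_bilinear (hS : ∀ v ∈ S, X v ∈ S)
    (hB : ∀ u ∈ S, ∀ v ∈ S, X (B u v) = B (X u) v + B u (X v)) (n : ℕ) (hu : u ∈ S) (hv : v ∈ S) :
    (X ^ n) (B u v) = ∑ p ∈ antidiagonal n, n.choose p.1 • B ((X ^ p.1) u) ((X ^ p.2) v) := by
  induction n generalizing u v with
  | zero => simp
  | succ n ih =>
    rw [sum_antidiagonal_choose_succ_nsmul (fun i j => B ((X ^ i) u) ((X ^ j) v)), pow_succ,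
      Module.End.mul_apply, hB u hu v hv, map_add, ih (hS u hu) hv, ih hu (hS v hv), add_comm]
    congr 1
    refine sum_congr rfl fun p hp => ?_
    rw [Nat.choose_symm_of_eq_add (mem_antidiagonal.1 hp).symm]
    rfl

/-- In the Leibniz expansion of order `N + N` one of the two exponents is at least `N`. Membership
of `B u v` in `S` plays no role. -/
lemma exists_pow_apply_bilinear_eq_zero (hS : ∀ v ∈ S, X v ∈ S)
    (hB : ∀ u ∈ S, ∀ v ∈ S, X (B u v) = B (X u) v + B u (X v)) (hu : u ∈ S) (hv : v ∈ S)
    (hu' : (X ^ N) u = 0) (hv' : (X ^ N) v = 0) : (X ^ (N + N)) (B u v) = 0 := by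
  rw [pow_apply_bilinear hS hB _ hu hv]
  refine sum_eq_zero fun p hp => ?_
  have := mem_antidiagonal.1 hp
  rcases le_or_gt N p.1 with h | h
  · simp [pow_apply_eq_zero hu' h]
  · simp [pow_apply_eq_zero hv' (show N ≤ p.2 by omega)]

/-- The exponential of a derivation of a bilinear product is an automorphism. -/
lemma expSeries_bilinear (hS : ∀ v ∈ S, X v ∈ S)
    (hB : ∀ u ∈ S, ∀ v ∈ S, X (B u v) = B (X u) v + B u (X v)) (hu : u ∈ S) (hv : v ∈ S)
    (hu' : ∃ N, (X ^ N) u = 0) (hv' : ∃ N, (X ^ N) v = 0) (t : ℝ) :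
    expSeries X t (B u v) = B (expSeries X t u) (expSeries X t v) := by
  obtain ⟨M, hM⟩ := hu'
  obtain ⟨N, hN⟩ := hv'
  have h1 := pow_apply_eq_zero hM (le_max_left M N)
  have h2 := pow_apply_eq_zero hN (le_max_right M N)
  rw [expSeries_eq_sum h1, expSeries_eq_sum h2,
    expSeries_eq_sum (exists_pow_apply_bilinear_eq_zero hS hB hu hv h1 h2), LinearMap.map_sum₂]
  simp only [map_sum]
  rw [← sum_range_sum_antidiagonal (g := fun i j => B ((t ^ i / (i.factorial : ℝ)) • (X ^ i) u)
    ((t ^ j / (j.factorial : ℝ)) • (X ^ j) v))]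
  · refine sum_congr rfl fun n _ => ?_
    rw [pow_apply_bilinear hS hB n hu hv, smul_sum]
    refine sum_congr rfl fun p hp => ?_
    obtain ⟨i, j⟩ := p
    obtain rfl : i + j = n := mem_antidiagonal.1 hp
    rw [map_smul, LinearMap.map_smul₂, smul_smul, ← Nat.cast_smul_eq_nsmul ℝ, smul_smul,
      pow_div_factorial_mul_choose, mul_comm]
  · rintro i j (h | h)
    · rw [pow_apply_eq_zero h1 h, smul_zero, LinearMap.map_zero₂]
    · rw [pow_apply_eq_zero h2 h, smul_zero, map_zero]

end Exp

/-! ### Hamiltonian flows -/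

variable {R P : Type*} [CommRing R] [Algebra ℝ R] [AddCommGroup P] [Module R P]

section Flow

/-- The Hamiltonian vector field of `W` as a linear operator. -/
def hamₗ (W : MFn R P) : Module.End ℝ (MFn R P) where
  toFun := brₗ W
  map_add' := brₗ_add_right W
  map_smul' c F := brₗ_smul_right W F c

/-- `br` as a bilinear map. -/
def brBilin : MFn R P →ₗ[ℝ] MFn R P →ₗ[ℝ] MFn R P :=
  LinearMap.mk₂ ℝ brₗ brₗ_add_left (fun c F G => brₗ_smul_left F G c) brₗ_add_right
    (fun c F G => brₗ_smul_right F G c)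

/-- `mul` as a bilinear map. -/
def mulBilin : MFn R P →ₗ[ℝ] MFn R P →ₗ[ℝ] MFn R P :=
  LinearMap.mk₂ ℝ mulₗ mulₗ_add_left (fun c F G => mulₗ_smul_left F G c) mulₗ_add_right
    (fun c F G => mulₗ_smul_right F G c)

/-- The inclusion of the multilinear functions. -/
def inclₗ : MFn R P →ₗ[ℝ] Fn R P := (multilinearFn R P).subtype

variable {W F G : MFn R P}

lemma coe_hamₗ_pow (n : ℕ) : ((hamₗ W ^ n) F).1 = (br W.1)^[n] F.1 := by
  induction n generalizing F with
  | zero => rfl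
  | succ n ih => rw [pow_succ, Function.iterate_succ_apply]; exact ih

lemma coe_expSeries (h : ∃ N, (hamₗ W ^ N) F = 0) (t : ℝ) :
    flow W.1 t F.1 = (expSeries (hamₗ W) t F).1 := by
  obtain ⟨N, hN⟩ := h
  rw [expSeries_eq_sum hN]
  change _ = inclₗ (∑ n ∈ Finset.range N, (t ^ n / (n.factorial : ℝ)) • (hamₗ W ^ n) F)
  rw [map_sum]
  refine (finsum_eq_sum_of_support_subset _ (s := Finset.range N) fun n hn => ?_).trans
    (Finset.sum_congr rfl fun n _ => ?_)
  · by_contra hn'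
    simp only [Finset.coe_range, Set.mem_Iio, not_lt] at hn'
    refine hn ?_
    simp only [← coe_hamₗ_pow, pow_apply_eq_zero hN hn']
    exact smul_zero _
  · rw [map_smul, ← coe_hamₗ_pow]
    rfl

/-- The polynomial functions, as multilinear functions. -/
def polyₗ (R P : Type*) [CommRing R] [Algebra ℝ R] [AddCommGroup P] [Module R P] :
    Submodule ℝ (MFn R P) := (Poly R P).comap inclₗ

lemma poly_le_multilinearFn : Poly R P ≤ multilinearFn R P :=
  iSup_le fun _ => iSup_le fun _ _ hF => mem_multilinearFn_of_mem_bi hF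

lemma bi_le_poly (k l : ℕ) : (bi k l : Submodule ℝ (Fn R P)) ≤ Poly R P :=
  (le_iSup (fun l => (bi k l : Submodule ℝ (Fn R P))) l).trans
    (le_iSup (fun k => ⨆ l, (bi k l : Submodule ℝ (Fn R P))) k)

lemma IsMultiderivation.mem_poly {k l : ℕ} (hF : IsMultiderivation k l F) : F ∈ polyₗ R P :=
  bi_le_poly k l (coe_mem_bi_iff.2 hF)

/-- `Poly` is spanned inside the space of all maps, where the bracket is not bilinear; the induction
over the supremum therefore carries multilinearity along. -/
lemma poly_induction {q : (F : MFn R P) → F ∈ polyₗ R P → Prop} (zero : q 0 (zero_mem _))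
    (add : ∀ F G hF hG, q F hF → q G hG → q (F + G) (add_mem hF hG))
    (bihomogeneous : ∀ (k l : ℕ) (F : MFn R P) (hF : IsMultiderivation k l F), q F hF.mem_poly)
    {F : MFn R P} (hF : F ∈ polyₗ R P) : q F hF := by
  let p : MFn R P → Prop := fun F => ∃ hF, q F hF
  have zero : p 0 := ⟨_, zero⟩
  have add : ∀ F G, p F → p G → p (F + G) := fun F G hF hG => ⟨_, add F G _ _ hF.2 hG.2⟩
  have bihomogeneous : ∀ (k l : ℕ) (F : MFn R P), IsMultiderivation k l F → p F :=
    fun k l F hF => ⟨_, bihomogeneous k l F hF⟩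
  have key : ∀ F ∈ Poly R P, ∃ h : F ∈ multilinearFn R P, p ⟨F, h⟩ := by
    intro F hF
    induction hF using Submodule.iSup_induction' with
    | mem k F hF =>
      induction hF using Submodule.iSup_induction' with
      | mem l F hF =>
        exact ⟨mem_multilinearFn_of_mem_bi hF, bihomogeneous k l _ (coe_mem_bi_iff.1 hF)⟩
      | zero => exact ⟨zero_mem _, zero⟩
      | add F G _ _ hF hG =>
        obtain ⟨hF, hF'⟩ := hF
        obtain ⟨hG, hG'⟩ := hG
        exact ⟨add_mem hF hG, add _ _ hF' hG'⟩
    | zero => exact ⟨zero_mem _, zero⟩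
    | add F G _ _ hF hG =>
      obtain ⟨hF, hF'⟩ := hF
      obtain ⟨hG, hG'⟩ := hG
      exact ⟨add_mem hF hG, add _ _ hF' hG'⟩
  exact (key F.1 hF).2.2

/-- The bracket has bidegree `(k + k' - 1, l + l' - 1)`, which may have an entry `-1`. In that case
it is zero. -/
lemma IsMultiderivation.br_mem_poly {k l k' l' : ℤ} (hF : IsMultiderivation k l F)
    (hG : IsMultiderivation k' l' G) : brₗ F G ∈ polyₗ R P := by
  have h := hF.br hG
  by_cases hn : k + k' - 1 < 0 ∨ l + l' - 1 < 0
  · rw [h.eq_zero hn]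
    exact zero_mem _
  · push Not at hn
    generalize k + k' - 1 = m at h hn
    generalize l + l' - 1 = n at h hn
    lift m to ℕ using hn.1
    lift n to ℕ using hn.2
    exact h.mem_poly

lemma brₗ_mem_polyₗ (hF : F ∈ polyₗ R P) (hG : G ∈ polyₗ R P) : brₗ F G ∈ polyₗ R P := by
  induction hF using poly_induction with
  | zero => rw [brₗ_zero_left]; exact zero_mem _
  | add F F' _ _ hF hF' => rw [brₗ_add_left]; exact add_mem hF hF'
  | bihomogeneous k l F hF =>
    induction hG using poly_induction with
    | zero => rw [brₗ_zero_right]; exact zero_mem _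
    | add G G' _ _ hG hG' => rw [brₗ_add_right]; exact add_mem hG hG'
    | bihomogeneous k' l' G hG => exact hF.br_mem_poly hG

/-- `X_W` is a derivation of the bracket. -/
lemma hamₗ_brₗ {a b : ℤ} (hW : IsMultiderivation a b W) (hab : Even (a + b))
    (hF : F ∈ polyₗ R P) (hG : G ∈ polyₗ R P) :
    hamₗ W (brₗ F G) = brₗ (hamₗ W F) G + brₗ F (hamₗ W G) := by
  have h0 : HasPar 0 W := hW.hasPar (by rwa [add_comm b, Nat.cast_zero, add_zero])
  change brₗ W (brₗ F G) = brₗ (brₗ W F) G + brₗ F (brₗ W G)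
  induction hF using poly_induction with
  | zero => simp only [brₗ_zero_left, brₗ_zero_right, add_zero]
  | add F F' _ _ hF hF' => simp only [brₗ_add_left, brₗ_add_right, hF, hF']; abel
  | bihomogeneous k l F hF =>
    obtain ⟨p, hp⟩ := hF.exists_hasPar
    induction hG using poly_induction with
    | zero => simp only [brₗ_zero_right, add_zero]
    | add G G' _ _ hG hG' => simp only [brₗ_add_right, hG, hG']; abel
    | bihomogeneous k' l' G hG =>
      obtain ⟨q, hq⟩ := hG.exists_hasPar
      rw [brₗ_jacobi h0 hp hq hW.symm hF.symm hG.symm, zero_mul, pow_zero, one_smul]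

/-- `X_W` is a derivation of the product. -/
lemma hamₗ_mulₗ {a b : ℤ} (hW : IsMultiderivation a b W) (hab : Even (a + b))
    (hF : F ∈ polyₗ R P) (hG : G ∈ polyₗ R P) :
    hamₗ W (mulₗ F G) = mulₗ (hamₗ W F) G + mulₗ F (hamₗ W G) := by
  have h0 : HasPar 0 W := hW.hasPar (by rwa [add_comm b, Nat.cast_zero, add_zero])
  change brₗ W (mulₗ F G) = mulₗ (brₗ W F) G + mulₗ F (brₗ W G)
  induction hF using poly_induction with
  | zero => simp only [brₗ_zero_right, mulₗ_zero_left, add_zero]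
  | add F F' _ _ hF hF' => simp only [mulₗ_add_left, brₗ_add_right, hF, hF']; abel
  | bihomogeneous k l F hF =>
    obtain ⟨p, hp⟩ := hF.exists_hasPar
    induction hG using poly_induction with
    | zero =>
      have h (K : MFn R P) : mulₗ K 0 = 0 := by
        simpa only [zero_smul] using mulₗ_smul_right K 0 0
      simp only [h, brₗ_zero_right, add_zero]
    | add G G' _ _ hG hG' => simp only [mulₗ_add_right, brₗ_add_right, hG, hG']; abel
    | bihomogeneous k' l' G hG =>
      obtain ⟨q, hq⟩ := hG.exists_hasPar
      rw [brₗ_mulₗ h0 hp hq hW.deriv, zero_mul, pow_zero, one_smul]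

lemma hamₗ_antisymm {a b : ℤ} (hW : IsMultiderivation a b W) (hab : Even (a + b))
    (hF : F ∈ polyₗ R P) : brₗ F W = -brₗ W F := by
  have h0 : HasPar 0 W := hW.hasPar (by rwa [add_comm b, Nat.cast_zero, add_zero])
  induction hF using poly_induction with
  | zero => simp only [brₗ_zero_left, brₗ_zero_right, neg_zero]
  | add F F' _ _ hF hF' => simp only [brₗ_add_left, brₗ_add_right, hF, hF']; abel
  | bihomogeneous k l F hF =>
    obtain ⟨p, hp⟩ := hF.exists_hasPar
    rw [brₗ_antisymm hp h0, mul_zero, pow_zero, one_smul]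

/-! ### The unit, the total weight and canonical flows. -/

lemma isMultiderivation_of_mem_bi {k l : ℕ} {F : Fn R P} (hF : F ∈ bi k l) :
    IsMultiderivation k l (⟨F, mem_multilinearFn_of_mem_bi hF⟩ : MFn R P) := coe_mem_bi_iff.1 hF

lemma unit_mem_bi : (unit : Fn R P) ∈ bi 0 0 where
  arity fs h := by
    match fs with
    | [] => exact absurd rfl h
    | _ :: _ => rfl
  multilinear l₁ l₂ c f g := by
    have h (l : List (Form R P)) (f : Form R P) : (unit : Fn R P) (l ++ f :: l₂) = 0 := by
      cases l <;> rfl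
    simp only [h, smul_zero, add_zero]
  symmetric l₁ l₂ p q f g _ _ := by
    have h (f g : Form R P) : (unit : Fn R P) (l₁ ++ f :: g :: l₂) = 0 := by
      cases l₁ <;> rfl
    simp only [h, smul_zero]
  leibniz l₁ f g := by
    have h (f : Form R P) : (unit : Fn R P) (l₁ ++ [f]) = 0 := by
      cases l₁ <;> rfl
    simp only [h, parity_zero, zero_mul, mul_zero, add_zero]
  degree fs a h := by
    cases h with
    | nil =>
      rw [mem_formDeg_iff]
      refine Or.inr ⟨by simp, ?_⟩
      change (1 : Form R P) ∈ LinearMap.range (ExteriorAlgebra.ι R) ^ 0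
      rw [pow_zero]
      exact Submodule.one_le.1 le_rfl
    | cons _ _ => exact Submodule.zero_mem _

lemma wt_le_poly (n : ℕ) : (wt n : Submodule ℝ (Fn R P)) ≤ Poly R P :=
  iSup_le fun k => iSup_le fun l => iSup_le fun _ => bi_le_poly k l

lemma bi_le_wt {k l n : ℕ} (h : k + l = n) : (bi k l : Submodule ℝ (Fn R P)) ≤ wt n :=
  le_iSup_of_le k (le_iSup_of_le l (le_iSup_of_le h le_rfl))

/-- The Hamiltonian vector field of a function of weight two preserves the weight. -/
lemma br_mem_wt {a b : ℕ} (hW : IsMultiderivation a b W) (hab : a + b = 2) {n : ℕ}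
    {F : Fn R P} (hF : F ∈ wt n) :
    br W.1 F ∈ wt n := by
  -- The inequality is stated through the inclusion of the multilinear functions, on which `X_W` is
  -- linear, so that it can be checked on each `bi k l`. There the weight changes by `a + b - 2 =
  -- 0`.
  have key : wt n ≤ ((wt n).comap (inclₗ ∘ₗ hamₗ W)).map inclₗ := by
    refine iSup_le fun k => iSup_le fun l => iSup_le fun hkl F hF => ?_
    refine ⟨⟨F, mem_multilinearFn_of_mem_bi hF⟩, ?_, rfl⟩
    have h := hW.br (isMultiderivation_of_mem_bi hF)
    change (brₗ W ⟨F, mem_multilinearFn_of_mem_bi hF⟩).1 ∈ wt n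
    by_cases hn : (a : ℤ) + k - 1 < 0 ∨ (b : ℤ) + l - 1 < 0
    · rw [h.eq_zero hn]
      exact zero_mem _
    · have h1 : (a : ℤ) + k - 1 = (a + k - 1 : ℕ) := by omega
      have h2 : (b : ℤ) + l - 1 = (b + l - 1 : ℕ) := by omega
      rw [h1, h2] at h
      exact bi_le_wt (by omega) (coe_mem_bi_iff.2 h)
  obtain ⟨G, hG, rfl⟩ := key hF
  exact hG

/-- A Hamiltonian of weight two generates a canonical flow if its Hamiltonian vector field is
locally nilpotent. -/
theorem hasCanonicalFlow_of_locallyNilpotent {a b : ℕ} (hW : IsMultiderivation a b W)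
    (hab : a + b = 2) (h₀ : a = 0 ∨ b = 0)
    (hN : ∀ F ∈ polyₗ R P, ∃ N, (hamₗ W ^ N) F = 0) :
    HasCanonicalFlow W.1 := by
  have hab' : Even ((a : ℤ) + b) := by
    rw [← Nat.cast_add, hab]
    exact even_two
  have hst : ∀ F ∈ polyₗ R P, hamₗ W F ∈ polyₗ R P := fun F hF => brₗ_mem_polyₗ hW.mem_poly hF
  have hlift (F : Fn R P) (hF : F ∈ Poly R P) : ∃ K : MFn R P, K.1 = F ∧ K ∈ polyₗ R P :=
    ⟨⟨F, poly_le_multilinearFn hF⟩, rfl, hF⟩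
  have hfl (t : ℝ) (F : MFn R P) (hF : F ∈ polyₗ R P) :
      flow W.1 t F.1 = (expSeries (hamₗ W) t F).1 := coe_expSeries (hN F hF) t
  have hmaps (t : ℝ) (F : MFn R P) (hF : F ∈ polyₗ R P) :
      expSeries (hamₗ W) t F ∈ polyₗ R P := by
    obtain ⟨N, h⟩ := hN F hF
    exact expSeries_mem hst h hF t
  have hadd (s t : ℝ) (F : Fn R P) (hF : F ∈ Poly R P) :
      flow W.1 (s + t) F = flow W.1 s (flow W.1 t F) := by
    obtain ⟨F, rfl, hF⟩ := hlift F hF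
    rw [hfl t F hF, hfl _ F hF, hfl s _ (hmaps t F hF), expSeries_add (hN F hF)]
  have hzero (F : Fn R P) (hF : F ∈ Poly R P) : flow W.1 0 F = F := by
    obtain ⟨F, rfl, hF⟩ := hlift F hF
    rw [hfl 0 F hF, expSeries_zero]
  have hmem (t : ℝ) : Set.MapsTo (flow W.1 t) (Poly R P) (Poly R P) := fun F hF => by
    obtain ⟨F, rfl, hF⟩ := hlift F hF
    rw [hfl t F hF]
    exact hmaps t F hF
  refine ⟨?_, hzero, hadd, fun t => ?_⟩
  · intro F hF
    obtain ⟨F, rfl, hF⟩ := hlift F hF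
    obtain ⟨N, h⟩ := hN F hF
    refine ⟨N, fun n hn => ?_⟩
    rw [← coe_hamₗ_pow, pow_apply_eq_zero h hn]
    rfl
  · refine ⟨Set.InvOn.bijOn (f' := flow W.1 (-t)) ⟨?_, ?_⟩ (hmem t) (hmem (-t)), ?_, ?_, ?_, ?_, ?_,
      ?_⟩
    · intro F hF
      rw [← hadd _ _ F hF, neg_add_cancel, hzero F hF]
    · intro F hF
      rw [← hadd _ _ F hF, add_neg_cancel, hzero F hF]
    · intro F hF G hG
      obtain ⟨F, rfl, hF⟩ := hlift F hF
      obtain ⟨G, rfl, hG⟩ := hlift G hG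
      rw [hfl t F hF, hfl t G hG]
      exact (hfl t (F + G) (add_mem hF hG)).trans
        (congrArg Subtype.val (expSeries_add_right (hN F hF) (hN G hG) t))
    · intro c F hF
      obtain ⟨F, rfl, hF⟩ := hlift F hF
      rw [hfl t F hF]
      exact (hfl t (c • F) (Submodule.smul_mem _ c hF)).trans
        (congrArg Subtype.val (expSeries_smul (hN F hF) t c))
    · obtain ⟨U, hU, hU'⟩ : ∃ U : MFn R P, U.1 = unit ∧ IsMultiderivation (0 : ℕ) (0 : ℕ) U :=
        ⟨_, rfl, isMultiderivation_of_mem_bi unit_mem_bi⟩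
      -- The bracket `{W, 1}` has bidegree `(a - 1, b - 1)`, and one entry is `-1`.
      have h1 : (hamₗ W ^ 1) U = 0 := by
        rw [pow_one]
        have h := hW.br hU'
        exact h.eq_zero (by omega)
      rw [← hU, hfl t U hU'.mem_poly, expSeries_eq_sum h1]
      simp
    · intro F hF G hG
      obtain ⟨F, rfl, hF⟩ := hlift F hF
      obtain ⟨G, rfl, hG⟩ := hlift G hG
      rw [hfl t F hF, hfl t G hG]
      have h1 : ∀ u ∈ polyₗ R P, ∀ v ∈ polyₗ R P, hamₗ W (mulBilin u v) =
          mulBilin (hamₗ W u) v + mulBilin u (hamₗ W v) := fun u hu v hv => hamₗ_mulₗ hW hab' hu hv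
      obtain ⟨M, hM⟩ := hN F hF
      obtain ⟨N, hN'⟩ := hN G hG
      -- Nilpotency on the product comes from the Leibniz rule, without knowing that the product is
      -- polynomial.
      have h2 := exists_pow_apply_bilinear_eq_zero hst h1 hF hG
        (pow_apply_eq_zero hM (le_max_left M N)) (pow_apply_eq_zero hN' (le_max_right M N))
      exact (coe_expSeries ⟨_, h2⟩ t).trans (congrArg Subtype.val
        (expSeries_bilinear hst h1 hF hG ⟨M, hM⟩ ⟨N, hN'⟩ t))
    · intro F hF G hG
      obtain ⟨F, rfl, hF⟩ := hlift F hF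
      obtain ⟨G, rfl, hG⟩ := hlift G hG
      rw [hfl t F hF, hfl t G hG]
      have h1 : ∀ u ∈ polyₗ R P, ∀ v ∈ polyₗ R P, hamₗ W (brBilin u v) =
          brBilin (hamₗ W u) v + brBilin u (hamₗ W v) := fun u hu v hv => hamₗ_brₗ hW hab' hu hv
      exact (coe_expSeries (hN _ (brₗ_mem_polyₗ hF hG)) t).trans (congrArg Subtype.val
        (expSeries_bilinear hst h1 hF hG (hN F hF) (hN G hG) t))
    · intro n F hF
      have hF' : F ∈ Poly R P := wt_le_poly n hF
      obtain ⟨F, rfl, hF'⟩ := hlift F hF'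
      obtain ⟨N, h⟩ := hN F hF'
      rw [hfl t F hF']
      refine expSeries_mem (S := (wt n).comap inclₗ) ?_ h hF t
      exact fun G hG => br_mem_wt hW hab hG

end Flow

end

section

variable {R P : Type*} [CommRing R] [Algebra ℝ R] [AddCommGroup P] [Module R P]

/-! ### Powers of a Hamiltonian vector field -/

section Powers

variable {W F G : MFn R P} {a b k l k' l' : ℤ}

lemma IsMultiderivation.cast (hF : IsMultiderivation k l F) (hk : k = k') (hl : l = l') :
    IsMultiderivation k' l' F := hk ▸ hl ▸ hF

lemma IsMultiderivation.ham_pow (hW : IsMultiderivation a b W) (hF : IsMultiderivation k l F)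
    (n : ℕ) : IsMultiderivation (k + n * (a - 1)) (l + n * (b - 1)) ((hamₗ W ^ n) F) := by
  induction n with
  | zero => exact hF.cast (by simp) (by simp)
  | succ n ih =>
    rw [pow_succ']
    exact (hW.br ih).cast (by push_cast; ring) (by push_cast; ring)

/-- Each application of `X_W` lowers the first degree by one if `a = 0`, the second if `b = 0`, so
`k + 1` or `l + 1` applications lead to degree `-1`. -/
lemma exists_hamₗ_pow_eq_zero (hW : IsMultiderivation a b W) (hab : a = 0 ∨ b = 0)
    (hF : F ∈ polyₗ R P) : ∃ N, (hamₗ W ^ N) F = 0 := by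
  induction hF using poly_induction with
  | zero => exact ⟨0, map_zero _⟩
  | add F G _ _ hF hG =>
    obtain ⟨M, hM⟩ := hF
    obtain ⟨N, hN⟩ := hG
    refine ⟨max M N, ?_⟩
    rw [map_add, pow_apply_eq_zero hM (le_max_left M N), pow_apply_eq_zero hN (le_max_right M N),
      add_zero]
  | bihomogeneous k l F hF =>
    rcases hab with rfl | rfl
    · exact ⟨k + 1, (hW.ham_pow hF (k + 1)).eq_zero (Or.inl (by push_cast; linarith))⟩
    · exact ⟨l + 1, (hW.ham_pow hF (l + 1)).eq_zero (Or.inr (by push_cast; linarith))⟩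

lemma mem_polyₗ_of_isMultiderivation (hF : IsMultiderivation k l F) : F ∈ polyₗ R P := by
  by_cases hn : k < 0 ∨ l < 0
  · rw [hF.eq_zero hn]
    exact zero_mem _
  · push Not at hn
    lift k to ℕ using hn.1
    lift l to ℕ using hn.2
    exact hF.mem_poly

lemma expSeries_one_of_nilpotent {V : Type*} [AddCommGroup V] [Module ℝ V] {X : Module.End ℝ V}
    {v₀ v₁ v₂ v₃ : V} (h₀ : X v₀ = 0) (h₁ : (X ^ 2) v₁ = 0) (h₂ : (X ^ 3) v₂ = 0)
    (h₃ : (X ^ 4) v₃ = 0) :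
    expSeries X 1 (v₀ + v₁ + v₂ + v₃) = v₀ + (v₁ + X v₁) +
      (v₂ + X v₂ + (1 / 2 : ℝ) • X (X v₂)) +
      (v₃ + X v₃ + (1 / 2 : ℝ) • X (X v₃) + (1 / 6 : ℝ) • X (X (X v₃))) := by
  have e₀ : (X ^ 1) v₀ = 0 := by rwa [pow_one]
  have n₀ : ∃ N, (X ^ N) v₀ = 0 := ⟨_, e₀⟩
  have n₁ : ∃ N, (X ^ N) v₁ = 0 := ⟨_, h₁⟩
  have n₂ : ∃ N, (X ^ N) v₂ = 0 := ⟨_, h₂⟩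
  have n₃ : ∃ N, (X ^ N) v₃ = 0 := ⟨_, h₃⟩
  have n₀₁ : ∃ N, (X ^ N) (v₀ + v₁) = 0 :=
    ⟨2, by rw [map_add, h₁, pow_apply_eq_zero e₀ one_le_two, add_zero]⟩
  have n₀₁₂ : ∃ N, (X ^ N) (v₀ + v₁ + v₂) = 0 :=
    ⟨3, by rw [map_add, map_add, h₂, pow_apply_eq_zero e₀ (by norm_num),
      pow_apply_eq_zero h₁ (by norm_num), add_zero, add_zero]⟩
  rw [expSeries_add_right n₀₁₂ n₃, expSeries_add_right n₀₁ n₂, expSeries_add_right n₀ n₁,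
    expSeries_eq_sum e₀, expSeries_eq_sum h₁, expSeries_eq_sum h₂, expSeries_eq_sum h₃]
  simp [Finset.sum_range_succ, Nat.factorial, pow_succ]

/-! ### Lowering and raising indices -/

lemma brₗ_ham_pow (hW : IsMultiderivation a b W) (hab : Even (a + b)) (hF : F ∈ polyₗ R P)
    (hG : G ∈ polyₗ R P) (h : brₗ W G = 0) (n : ℕ) :
    brₗ ((hamₗ W ^ n) F) G = (hamₗ W ^ n) (brₗ F G) := by
  have hX (F : MFn R P) (hF : F ∈ polyₗ R P) : hamₗ W F ∈ polyₗ R P :=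
    brₗ_mem_polyₗ (mem_polyₗ_of_isMultiderivation hW) hF
  induction n generalizing F with
  | zero => rfl
  | succ n ih =>
    rw [pow_succ, Module.End.mul_apply, Module.End.mul_apply, ih (hX F hF),
      hamₗ_brₗ hW hab hF hG]
    change _ = (hamₗ W ^ n) (_ + brₗ F (brₗ W G))
    rw [h, brₗ_zero_right, add_zero]

/-- The derivation property gives `{X_W K, G} = X_W {K, G} + {K, {G, W}}`. Starting from `{F, G} =
0`, each of the `n + 1` factors `X_W` contributes one copy of the same term, because `{G, W}`
commutes with `W`. -/
lemma brₗ_ham_pow_succ (hW : IsMultiderivation a b W) (hab : Even (a + b)) (hF : F ∈ polyₗ R P)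
    (hG : G ∈ polyₗ R P) (h₀ : brₗ F G = 0) (h : brₗ W (brₗ G W) = 0) (n : ℕ) :
    brₗ ((hamₗ W ^ (n + 1)) F) G = ((n : ℝ) + 1) • (hamₗ W ^ n) (brₗ F (brₗ G W)) := by
  have hWp := mem_polyₗ_of_isMultiderivation hW
  have hX (F : MFn R P) (hF : F ∈ polyₗ R P) : hamₗ W F ∈ polyₗ R P := brₗ_mem_polyₗ hWp hF
  have hGW : brₗ W G = -brₗ G W := by rw [hamₗ_antisymm hW hab hG, neg_neg]
  have step (K : MFn R P) (hK : K ∈ polyₗ R P) :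
      brₗ (hamₗ W K) G = hamₗ W (brₗ K G) + brₗ K (brₗ G W) := by
    rw [hamₗ_brₗ hW hab hK hG]
    change _ = _ + brₗ K (brₗ W G) + _
    rw [hGW, brₗ_neg_right]
    abel
  have hpow (n : ℕ) : (hamₗ W ^ n) F ∈ polyₗ R P := by
    induction n with
    | zero => exact hF
    | succ n ih => rw [pow_succ']; exact hX _ ih
  induction n with
  | zero =>
    rw [zero_add, pow_one, step F hF, h₀, map_zero]
    simp
  | succ n ih =>
    rw [pow_succ', Module.End.mul_apply, step _ (hpow _), ih,
      brₗ_ham_pow hW hab hF (brₗ_mem_polyₗ hG hWp) h, map_smul, ← Module.End.mul_apply,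
      ← pow_succ']
    push_cast
    module

/-- Contraction of `X_W^n S / n!` with arguments of two kinds: those killed by `X_W`, and those
killed by `X_W²`, which are replaced by their bracket with `W`. -/
lemma contract_ham_pow (hW : IsMultiderivation a b W) (hab : Even (a + b)) (𝒮 : Set (MFn R P))
    (𝒜 𝒴 : Set (Fn R P)) (h𝒮 : ∀ S ∈ 𝒮, S ∈ polyₗ R P)
    (h𝒜 : ∀ x ∈ 𝒜, ∃ A : MFn R P, A.1 = x ∧ A ∈ polyₗ R P ∧ brₗ W A = 0 ∧
      ∀ S ∈ 𝒮, brₗ S A ∈ 𝒮)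
    (h𝒴 : ∀ y ∈ 𝒴, ∃ Y : MFn R P, Y.1 = y ∧ Y ∈ polyₗ R P ∧ brₗ W (brₗ Y W) = 0 ∧
      ∀ S ∈ 𝒮, brₗ S Y = 0 ∧ brₗ S (brₗ Y W) ∈ 𝒮)
    {S : MFn R P} (hS : S ∈ 𝒮) (xs ys : List (Fn R P)) (hx : ∀ x ∈ xs, x ∈ 𝒜)
    (hy : ∀ y ∈ ys, y ∈ 𝒴) :
    contract ((1 / (ys.length.factorial : ℝ)) • (hamₗ W ^ ys.length) S).1 (xs ++ ys) =
      contract S.1 (xs ++ ys.map (tilde W.1)) := by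
  induction xs generalizing S with
  | nil =>
    induction ys generalizing S with
    | nil =>
      simp [contract]
    | cons y ys ih =>
      obtain ⟨Y, rfl, hY, hY', h⟩ := h𝒴 y (hy y (by simp))
      -- The factor `n + 1` from `brₗ_ham_pow_succ` turns `1 / (n + 1)!` into `1 / n!`, and `{Y, W}`
      -- is `tilde W Y`.
      have key : brₗ ((1 / ((ys.length + 1).factorial : ℝ)) • (hamₗ W ^ (ys.length + 1)) S) Y =
          (1 / (ys.length.factorial : ℝ)) • (hamₗ W ^ ys.length) (brₗ S (brₗ Y W)) := by
        rw [brₗ_smul_left, brₗ_ham_pow_succ hW hab (h𝒮 S hS) hY (h S hS).1 hY', smul_smul,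
          Nat.factorial_succ]
        congr 1
        push_cast
        field_simp
      have := ih (fun y hy' => hy y (List.mem_cons_of_mem _ hy')) (h S hS).2
      rw [← key] at this
      exact this
  | cons x xs ih =>
    obtain ⟨A, rfl, hA, hA', h⟩ := h𝒜 x (hx x (by simp))
    have key : brₗ ((1 / (ys.length.factorial : ℝ)) • (hamₗ W ^ ys.length) S) A =
        (1 / (ys.length.factorial : ℝ)) • (hamₗ W ^ ys.length) (brₗ S A) := by
      rw [brₗ_smul_left, brₗ_ham_pow hW hab (h𝒮 S hS) hA hA']
    have := ih (h S hS) (fun x hx' => hx x (by simp [hx']))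
    rw [← key] at this
    exact this

lemma exists_coe_eq {k l : ℕ} {F : Fn R P} (hF : F ∈ bi k l) :
    ∃ K : MFn R P, K.1 = F ∧ IsMultiderivation k l K :=
  ⟨⟨F, mem_multilinearFn_of_mem_bi hF⟩, rfl, isMultiderivation_of_mem_bi hF⟩

/-- The hypotheses of `contract_ham_pow` are all bidegree counts: `{ω, α}` and `{ω, {X, ω}}` have
first degree `-1`, while `{S, X}` has second degree `-1` for `S` of bidegree `(m, 0)`. The arity `m`
is left free since it drops with each contraction. -/
lemma isLowering_ham_pow {ω ψ : MFn R P} (hω : IsMultiderivation 0 2 ω)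
    (hψ : IsMultiderivation 3 0 ψ) {j : ℕ} (hj : j ≤ 3) :
    IsLowering j ω.1 ψ.1 ((1 / (j.factorial : ℝ)) • (hamₗ ω ^ j) ψ).1 := by
  have he : Even ((0 : ℤ) + 2) := by decide
  refine ⟨?_, ?_, ?_⟩
  · refine Submodule.smul_mem (bi (3 - j) j) _ (coe_mem_bi_iff.2 ?_)
    exact (hω.ham_pow hψ j).cast (by push_cast [hj]; ring) (by ring)
  · intro f hf
    obtain ⟨f, rfl, hf'⟩ := exists_coe_eq hf
    have h : brₗ ((1 / (j.factorial : ℝ)) • (hamₗ ω ^ j) ψ) f = 0 := by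
      rw [brₗ_smul_left, brₗ_ham_pow hω he (mem_polyₗ_of_isMultiderivation hψ) hf'.mem_poly
        ((hω.br hf').eq_zero (by norm_num)), (hψ.br hf').eq_zero (by norm_num), map_zero, smul_zero]
    exact congrArg Subtype.val h
  · intro α X _ hX hα hX'
    subst hX
    refine contract_ham_pow hω he {S | ∃ m : ℤ, IsMultiderivation m 0 S} {x | x ∈ bi 0 1}
      {x | x ∈ bi 1 0}      ?_ ?_ ?_ ⟨3, hψ⟩ α X hα hX'
    · rintro S ⟨m, hS⟩
      exact mem_polyₗ_of_isMultiderivation hS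
    · intro x hx
      obtain ⟨x, rfl, ix⟩ := exists_coe_eq hx
      refine ⟨x, rfl, ix.mem_poly, (hω.br ix).eq_zero (by norm_num), ?_⟩
      rintro S ⟨m, hS⟩
      exact ⟨_, (hS.br ix).cast rfl (by norm_num)⟩
    · intro y hy
      obtain ⟨y, rfl, iy⟩ := exists_coe_eq hy
      refine ⟨y, rfl, iy.mem_poly, (hω.br (iy.br hω)).eq_zero (by norm_num), ?_⟩
      rintro S ⟨m, hS⟩
      exact ⟨(hS.br iy).eq_zero (by norm_num), _, (hS.br (iy.br hω)).cast rfl (by norm_num)⟩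

lemma isRaising_ham_pow {π φ : MFn R P} (hπ : IsMultiderivation 2 0 π)
    (hφ : IsMultiderivation 0 3 φ) {j : ℕ} (hj : j ≤ 3) :
    IsRaising j π.1 φ.1 ((1 / (j.factorial : ℝ)) • (hamₗ π ^ j) φ).1 := by
  have he : Even ((2 : ℤ) + 0) := by decide
  refine ⟨?_, ?_, ?_⟩
  · refine Submodule.smul_mem (bi j (3 - j)) _ (coe_mem_bi_iff.2 ?_)
    exact (hπ.ham_pow hφ j).cast (by ring) (by push_cast [hj]; ring)
  · intro f hf
    obtain ⟨f, rfl, hf'⟩ := exists_coe_eq hf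
    have h : brₗ ((1 / (j.factorial : ℝ)) • (hamₗ π ^ j) φ) f = 0 := by
      rw [brₗ_smul_left, brₗ_ham_pow hπ he (mem_polyₗ_of_isMultiderivation hφ) hf'.mem_poly
        ((hπ.br hf').eq_zero (by norm_num)), (hφ.br hf').eq_zero (by norm_num), map_zero, smul_zero]
    exact congrArg Subtype.val h
  · intro X α _ hα hX hα'
    subst hα
    refine contract_ham_pow hπ he {S | ∃ m : ℤ, IsMultiderivation 0 m S} {x | x ∈ bi 1 0}
      {x | x ∈ bi 0 1}      ?_ ?_ ?_ ⟨3, hφ⟩ X α hX hα'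
    · rintro S ⟨m, hS⟩
      exact mem_polyₗ_of_isMultiderivation hS
    · intro x hx
      obtain ⟨x, rfl, ix⟩ := exists_coe_eq hx
      refine ⟨x, rfl, ix.mem_poly, (hπ.br ix).eq_zero (by norm_num), ?_⟩
      rintro S ⟨m, hS⟩
      exact ⟨_, (hS.br ix).cast (by norm_num) rfl⟩
    · intro y hy
      obtain ⟨y, rfl, iy⟩ := exists_coe_eq hy
      refine ⟨y, rfl, iy.mem_poly, (hπ.br (iy.br hπ)).eq_zero (by norm_num), ?_⟩
      rintro S ⟨m, hS⟩
      exact ⟨(hS.br iy).eq_zero (by norm_num), _, (hS.br (iy.br hπ)).cast (by norm_num) rfl⟩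

/-! ### The structure equation -/

lemma HasArity.eq_zero_of_add_eq_zero {k : ℤ} {K L : MFn R P} (hK : HasArity k K)
    (hL : ∀ fs : List (Form R P), (fs.length : ℤ) = k → L.1 fs = 0) (h : K + L = 0) : K = 0 := by
  apply Subtype.ext
  funext fs
  by_cases hfs : (fs.length : ℤ) = k
  · have := congrArg (fun K : MFn R P => K.1 fs) h
    change K.1 fs + L.1 fs = 0 at this
    rwa [hL fs hfs, add_zero] at this
  · exact hK fs hfs

lemma HasArity.add {k : ℤ} {K L : MFn R P} (hK : HasArity k K) (hL : HasArity k L) :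
    HasArity k (K + L) := fun fs h => by
  rw [coe_add, hK fs h, hL fs h, add_zero]

lemma HasArity.smul {k : ℤ} {K : MFn R P} (c : ℝ) (hK : HasArity k K) :
    HasArity k (c • K) := fun fs h => by
  rw [coe_smul, hK fs h, smul_zero]

/-- The bidegree components of the structure equation. -/
lemma brₗ_self_eq_zero_iff {μ γ φ ψ : MFn R P} (hμ : IsMultiderivation 1 2 μ)
    (hγ : IsMultiderivation 2 1 γ) (hφ : IsMultiderivation 0 3 φ) (hψ : IsMultiderivation 3 0 ψ) :
    brₗ (μ + γ + φ + ψ) (μ + γ + φ + ψ) = 0 ↔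
      brₗ μ φ = 0 ∧ (1 / 2 : ℝ) • brₗ μ μ + brₗ γ φ = 0 ∧ brₗ μ γ + brₗ φ ψ = 0 ∧
        (1 / 2 : ℝ) • brₗ γ γ + brₗ μ ψ = 0 ∧ brₗ γ ψ = 0 := by
  have pμ : HasPar 3 μ := hμ.hasPar (by decide)
  have pγ : HasPar 3 γ := hγ.hasPar (by decide)
  have pφ : HasPar 3 φ := hφ.hasPar (by decide)
  have pψ : HasPar 3 ψ := hψ.hasPar (by decide)
  have comm {F G : MFn R P} (hF : HasPar 3 F) (hG : HasPar 3 G) : brₗ F G = brₗ G F := by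
    rw [brₗ_antisymm hF hG]
    norm_num
  -- All four components are odd, so their brackets commute and mixed terms double; `{φ, φ}` and
  -- `{ψ, ψ}` have a degree `-1` and vanish.
  have h : brₗ (μ + γ + φ + ψ) (μ + γ + φ + ψ) = (2 : ℝ) • (brₗ μ φ +
      (((1 / 2 : ℝ) • brₗ μ μ + brₗ γ φ) + ((brₗ μ γ + brₗ φ ψ) +
        (((1 / 2 : ℝ) • brₗ γ γ + brₗ μ ψ) + brₗ γ ψ)))) := by
    simp only [brₗ_add_left, brₗ_add_right]
    rw [comm pφ pμ, comm pφ pγ, comm pγ pμ, comm pψ pμ, comm pψ pγ, comm pψ pφ,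
      (hφ.br hφ).eq_zero (by norm_num), (hψ.br hψ).eq_zero (by norm_num)]
    module
  rw [h]
  constructor
  · intro h
    replace h := (smul_eq_zero.1 h).resolve_left two_ne_zero
    -- The five groups have arities `0` to `4`. Evaluation on lists of a fixed length isolates one
    -- group, and they are split off in turn.
    have a0 : HasArity 0 (brₗ μ φ) := by simpa using (hμ.br hφ).arity
    have a1 : HasArity 1 ((1 / 2 : ℝ) • brₗ μ μ + brₗ γ φ) :=
      HasArity.add (.smul _ (by simpa using (hμ.br hμ).arity))
        (by have := (hγ.br hφ).arity; norm_num at this; exact this)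
    have a2 : HasArity 2 (brₗ μ γ + brₗ φ ψ) :=
      HasArity.add (by simpa using (hμ.br hγ).arity)
        (by have := (hφ.br hψ).arity; norm_num at this; exact this)
    have a3 : HasArity 3 ((1 / 2 : ℝ) • brₗ γ γ + brₗ μ ψ) :=
      HasArity.add (.smul _ (by have := (hγ.br hγ).arity; norm_num at this; exact this))
        (by simpa using (hμ.br hψ).arity)
    have a4 : HasArity 4 (brₗ γ ψ) := by have := (hγ.br hψ).arity; norm_num at this; exact this
    generalize brₗ μ φ = K₀, (1 / 2 : ℝ) • brₗ μ μ + brₗ γ φ = K₁, brₗ μ γ + brₗ φ ψ = K₂,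
      (1 / 2 : ℝ) • brₗ γ γ + brₗ μ ψ = K₃, brₗ γ ψ = K₄ at *
    have z0 : K₀ = 0 := a0.eq_zero_of_add_eq_zero (fun fs hfs => by
      simp only [coe_add, a1 fs (by omega), a2 fs (by omega), a3 fs (by omega), a4 fs (by omega),
        add_zero]) h
    rw [z0, zero_add] at h
    have z1 : K₁ = 0 := a1.eq_zero_of_add_eq_zero (fun fs hfs => by
      simp only [coe_add, a2 fs (by omega), a3 fs (by omega), a4 fs (by omega), add_zero]) h
    rw [z1, zero_add] at h
    have z2 : K₂ = 0 := a2.eq_zero_of_add_eq_zero (fun fs hfs => by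
      simp only [coe_add, a3 fs (by omega), a4 fs (by omega), add_zero]) h
    rw [z2, zero_add] at h
    have z3 : K₃ = 0 := a3.eq_zero_of_add_eq_zero (fun fs hfs => a4 fs (by omega)) h
    rw [z3, zero_add] at h
    exact ⟨z0, z1, z2, z3, h⟩
  · rintro ⟨h0, h1, h2, h3, h4⟩
    rw [h0, h1, h2, h3, h4]
    simp

lemma coe_eq_zero_iff {K : MFn R P} : K.1 = 0 ↔ K = 0 :=
  ⟨fun h => Subtype.ext h, fun h => congrArg Subtype.val h⟩

/-- A quasi-Lie bialgebroid on `(A, A^*)` is a proto-Lie bialgebroid with `ψ = 0`. -/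
lemma isQuasiLieBialgebroid_iff {μ γ φ : Fn R P} :
    IsQuasiLieBialgebroid μ γ φ ↔ IsProtoLieBialgebroid μ γ φ 0 := by
  constructor
  · rintro ⟨hμ, hγ, hφ, h1, h2, h3, h4⟩
    refine ⟨hμ, hγ, hφ, zero_mem _, ?_⟩
    obtain ⟨μ, rfl, iμ⟩ := exists_coe_eq hμ
    obtain ⟨γ, rfl, iγ⟩ := exists_coe_eq hγ
    obtain ⟨φ, rfl, iφ⟩ := exists_coe_eq hφ
    have i0 : IsMultiderivation 3 0 (0 : MFn R P) := coe_mem_bi_iff.1 (zero_mem (bi 3 0))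
    refine coe_eq_zero_iff.2 ((brₗ_self_eq_zero_iff iμ iγ iφ i0).2 ?_)
    have h1 : (1 / 2 : ℝ) • brₗ μ μ + brₗ γ φ = 0 := coe_eq_zero_iff.1 h1
    have h2 : brₗ γ γ = 0 := coe_eq_zero_iff.1 h2
    have h3 : brₗ μ γ = 0 := coe_eq_zero_iff.1 h3
    have h4 : brₗ μ φ = 0 := coe_eq_zero_iff.1 h4
    simp only [h1, h2, h3, h4, brₗ_zero_right, smul_zero, add_zero, and_self]
  · rintro ⟨hμ, hγ, hφ, -, h⟩
    obtain ⟨μ, rfl, iμ⟩ := exists_coe_eq hμ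
    obtain ⟨γ, rfl, iγ⟩ := exists_coe_eq hγ
    obtain ⟨φ, rfl, iφ⟩ := exists_coe_eq hφ
    have i0 : IsMultiderivation 3 0 (0 : MFn R P) := coe_mem_bi_iff.1 (zero_mem (bi 3 0))
    have h := (brₗ_self_eq_zero_iff iμ iγ iφ i0).1 (coe_eq_zero_iff.1 h)
    simp only [brₗ_zero_right, add_zero] at h
    obtain ⟨h0, h1, h2, h3, -⟩ := h
    exact ⟨hμ, hγ, hφ, coe_eq_zero_iff.2 h1,
      coe_eq_zero_iff.2 ((smul_eq_zero.1 h3).resolve_left (by norm_num)), coe_eq_zero_iff.2 h2,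
      coe_eq_zero_iff.2 h0⟩

/-- A quasi-Lie bialgebroid on `(A^*, A)` is a proto-Lie bialgebroid with `φ = 0`. -/
lemma isDualQuasiLieBialgebroid_iff {μ γ ψ : Fn R P} :
    IsDualQuasiLieBialgebroid μ γ ψ ↔ IsProtoLieBialgebroid μ γ 0 ψ := by
  constructor
  · rintro ⟨hμ, hγ, hψ, h1, h2, h3, h4⟩
    refine ⟨hμ, hγ, zero_mem _, hψ, ?_⟩
    obtain ⟨μ, rfl, iμ⟩ := exists_coe_eq hμ
    obtain ⟨γ, rfl, iγ⟩ := exists_coe_eq hγ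
    obtain ⟨ψ, rfl, iψ⟩ := exists_coe_eq hψ
    have i0 : IsMultiderivation 0 3 (0 : MFn R P) := coe_mem_bi_iff.1 (zero_mem (bi 0 3))
    refine coe_eq_zero_iff.2 ((brₗ_self_eq_zero_iff iμ iγ i0 iψ).2 ?_)
    have h1 : (1 / 2 : ℝ) • brₗ γ γ + brₗ μ ψ = 0 := coe_eq_zero_iff.1 h1
    have h2 : brₗ μ μ = 0 := coe_eq_zero_iff.1 h2
    have h3 : brₗ μ γ = 0 := coe_eq_zero_iff.1 h3
    have h4 : brₗ γ ψ = 0 := coe_eq_zero_iff.1 h4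
    simp only [h1, h2, h3, h4, brₗ_zero_right, brₗ_zero_left, smul_zero, add_zero, and_self]
  · rintro ⟨hμ, hγ, -, hψ, h⟩
    obtain ⟨μ, rfl, iμ⟩ := exists_coe_eq hμ
    obtain ⟨γ, rfl, iγ⟩ := exists_coe_eq hγ
    obtain ⟨ψ, rfl, iψ⟩ := exists_coe_eq hψ
    have i0 : IsMultiderivation 0 3 (0 : MFn R P) := coe_mem_bi_iff.1 (zero_mem (bi 0 3))
    have h := (brₗ_self_eq_zero_iff iμ iγ i0 iψ).1 (coe_eq_zero_iff.1 h)
    simp only [brₗ_zero_right, brₗ_zero_left, add_zero] at h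
    obtain ⟨-, h1, h2, h3, h4⟩ := h
    exact ⟨hμ, hγ, hψ, coe_eq_zero_iff.2 h3,
      coe_eq_zero_iff.2 ((smul_eq_zero.1 h1).resolve_left (by norm_num)), coe_eq_zero_iff.2 h2,
      coe_eq_zero_iff.2 h4⟩

lemma HasCanonicalFlow.br_flow_eq_zero_iff {H : Fn R P} {Θ : MFn R P} (hH : HasCanonicalFlow H)
    (hΘ : Θ ∈ polyₗ R P) (t : ℝ) :
    br (flow H t Θ.1) (flow H t Θ.1) = 0 ↔ br Θ.1 Θ.1 = 0 := by
  have h := hH.canonical t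
  have hb : br Θ.1 Θ.1 ∈ Poly R P := brₗ_mem_polyₗ hΘ hΘ
  have h0 : flow H t 0 = 0 := by
    have := h.map_smul 0 0 (zero_mem _)
    rwa [zero_smul, zero_smul] at this
  have hbr : flow H t (br Θ.1 Θ.1) = br (flow H t Θ.1) (flow H t Θ.1) := h.map_br _ hΘ _ hΘ
  rw [← hbr]
  constructor
  · intro h'
    exact h.bijOn.injOn hb (zero_mem (Poly R P)) (h'.trans h0.symm)
  · intro h'
    rw [h', h0]

/-! ### Twisting -/

lemma inv_factorial_smul_pow {V : Type*} [AddCommGroup V] [Module ℝ V] (X : Module.End ℝ V) (v : V) :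
    (1 / (Nat.factorial 1 : ℝ)) • (X ^ 1) v = X v ∧
    (1 / (Nat.factorial 2 : ℝ)) • (X ^ 2) v = (1 / 2 : ℝ) • X (X v) ∧
    (1 / (Nat.factorial 3 : ℝ)) • (X ^ 3) v = (1 / 6 : ℝ) • X (X (X v)) := by
  simp [Nat.factorial, pow_succ]

/-- The twist by `ω ∈ Γ(⋀² A^*)`. -/
theorem twist_form (ω : Fn R P) (hω : ω ∈ bi 0 2) :
    HasCanonicalFlow ω ∧
      ∀ μ ∈ bi 1 2, ∀ γ ∈ bi 2 1, ∀ φ ∈ bi 0 3, ∀ ψ ∈ bi 3 0,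
        ∃ h L₁ L₂ L₃ : Fn R P,
          IsLinearHamiltonian (derived γ ω) h ∧
          IsLowering 1 ω ψ L₁ ∧ IsLowering 2 ω ψ L₂ ∧ IsLowering 3 ω ψ L₃ ∧
          ∃ μω ∈ bi 1 2, ∃ γω ∈ bi 2 1, ∃ φω ∈ bi 0 3,
            flow ω 1 (μ + γ + φ + ψ) = μω + γω + φω + ψ ∧
            μω = μ + br ω γ + (1 / 2 : ℝ) • (br ω)^[2] ψ ∧
            μω = μ + h + L₂ ∧
            γω = γ + br ω ψ ∧
            γω = γ + L₁ ∧
            φω = φ + br ω μ + (1 / 2 : ℝ) • (br ω)^[2] γ + (1 / 6 : ℝ) • (br ω)^[3] ψ ∧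
            φω = φ - diff μ ω - (1 / 2 : ℝ) • derived γ ω ω + L₃ ∧
            (IsProtoLieBialgebroid μω γω φω ψ ↔ IsProtoLieBialgebroid μ γ φ ψ) ∧
            (ψ = 0 → IsQuasiLieBialgebroid μ γ φ → IsQuasiLieBialgebroid μω γω φω) ∧
            (φ = 0 → IsDualQuasiLieBialgebroid μ γ ψ →
              diff μ ω + (1 / 2 : ℝ) • derived γ ω ω = L₃ →
              φω = 0 ∧ IsDualQuasiLieBialgebroid μω γω ψ) := by
  obtain ⟨ω, rfl, iω⟩ := exists_coe_eq hω
  have hflow : HasCanonicalFlow ω.1 := hasCanonicalFlow_of_locallyNilpotent iω rfl (Or.inl rfl)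
    fun F hF => exists_hamₗ_pow_eq_zero iω (Or.inl rfl) hF
  refine ⟨hflow, fun μ hμ γ hγ φ hφ ψ hψ => ?_⟩
  obtain ⟨μ, rfl, iμ⟩ := exists_coe_eq hμ
  obtain ⟨γ, rfl, iγ⟩ := exists_coe_eq hγ
  obtain ⟨φ, rfl, iφ⟩ := exists_coe_eq hφ
  obtain ⟨ψ, rfl, iψ⟩ := exists_coe_eq hψ
  have he : Even (((0 : ℕ) : ℤ) + (2 : ℕ)) := by decide
  have e1 : br ω.1 γ.1 ∈ bi 1 2 := coe_mem_bi_iff.2 ((iω.br iγ).cast (by norm_num) (by norm_num))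
  have e2 : br ω.1 ψ.1 ∈ bi 2 1 := coe_mem_bi_iff.2 ((iω.br iψ).cast (by norm_num) (by norm_num))
  have e3 : br ω.1 μ.1 ∈ bi 0 3 := coe_mem_bi_iff.2 ((iω.br iμ).cast (by norm_num) (by norm_num))
  obtain ⟨f1, f2, f3⟩ := inv_factorial_smul_pow (hamₗ ω) ψ
  have l1 := isLowering_ham_pow iω iψ (j := 1) (by norm_num)
  have l2 := isLowering_ham_pow iω iψ (j := 2) (by norm_num)
  have l3 := isLowering_ham_pow iω iψ (j := 3) (by norm_num)
  rw [f1] at l1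
  rw [f2] at l2
  rw [f3] at l3
  have hX : flow ω.1 1 (μ + γ + φ + ψ).1 =
      ((μ + brₗ ω γ + (1 / 2 : ℝ) • brₗ ω (brₗ ω ψ)) + (γ + brₗ ω ψ) +
      (φ + brₗ ω μ + (1 / 2 : ℝ) • brₗ ω (brₗ ω γ) + (1 / 6 : ℝ) • brₗ ω (brₗ ω (brₗ ω ψ))) +
      ψ).1 := by
    have hp : μ + γ + φ + ψ ∈ polyₗ R P :=
      add_mem (add_mem (add_mem iμ.mem_poly iγ.mem_poly) iφ.mem_poly) iψ.mem_poly
    rw [coe_expSeries (exists_hamₗ_pow_eq_zero iω (Or.inl rfl) hp)]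
    have h0 : hamₗ ω φ = 0 := (iω.br iφ).eq_zero (by norm_num)
    have h1 : (hamₗ ω ^ 2) μ = 0 := (iω.ham_pow iμ 2).eq_zero (by norm_num)
    have h2 : (hamₗ ω ^ 3) γ = 0 := (iω.ham_pow iγ 3).eq_zero (by norm_num)
    have h3 : (hamₗ ω ^ 4) ψ = 0 := (iω.ham_pow iψ 4).eq_zero (by norm_num)
    have h := expSeries_one_of_nilpotent h0 h1 h2 h3
    -- The components are sorted by the power of `X_ω` that kills them.
    rw [show μ + γ + φ + ψ = φ + μ + γ + ψ by abel, h]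
    congr 1
    change φ + (μ + brₗ ω μ) + (γ + brₗ ω γ + (1 / 2 : ℝ) • brₗ ω (brₗ ω γ)) +
      (ψ + brₗ ω ψ + (1 / 2 : ℝ) • brₗ ω (brₗ ω ψ) + (1 / 6 : ℝ) • brₗ ω (brₗ ω (brₗ ω ψ))) = _
    abel
  have hd : diff μ.1 ω.1 = (-brₗ ω μ).1 := congrArg Subtype.val (hamₗ_antisymm iω he iμ.mem_poly)
  have hdd : derived γ.1 ω.1 ω.1 = (-brₗ ω (brₗ ω γ)).1 :=
    congrArg Subtype.val (hamₗ_antisymm iω he (brₗ_mem_polyₗ iω.mem_poly iγ.mem_poly))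
  have hφω : (φ + brₗ ω μ + (1 / 2 : ℝ) • brₗ ω (brₗ ω γ) +
      (1 / 6 : ℝ) • brₗ ω (brₗ ω (brₗ ω ψ))).1 =
      φ.1 - diff μ.1 ω.1 - (1 / 2 : ℝ) • derived γ.1 ω.1 ω.1 +
        ((1 / 6 : ℝ) • brₗ ω (brₗ ω (brₗ ω ψ))).1 := by
    rw [hd, hdd]
    have h : φ + brₗ ω μ + (1 / 2 : ℝ) • brₗ ω (brₗ ω γ) + (1 / 6 : ℝ) • brₗ ω (brₗ ω (brₗ ω ψ)) =
        φ - -brₗ ω μ - (1 / 2 : ℝ) • -brₗ ω (brₗ ω γ) +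
          (1 / 6 : ℝ) • brₗ ω (brₗ ω (brₗ ω ψ)) := by module
    exact congrArg Subtype.val h
  have mμ : (μ + brₗ ω γ + (1 / 2 : ℝ) • brₗ ω (brₗ ω ψ)).1 ∈ bi 1 2 :=
    add_mem (add_mem hμ e1) l2.1
  have mγ : (γ + brₗ ω ψ).1 ∈ bi 2 1 := add_mem hγ e2
  have mφ : (φ + brₗ ω μ + (1 / 2 : ℝ) • brₗ ω (brₗ ω γ) +
      (1 / 6 : ℝ) • brₗ ω (brₗ ω (brₗ ω ψ))).1 ∈ bi 0 3 := by
    refine add_mem (add_mem (add_mem hφ e3) (Submodule.smul_mem (bi 0 3) _ ?_)) l3.1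
    exact coe_mem_bi_iff.2 ((iω.br (iω.br iγ)).cast (by norm_num) (by norm_num))
  generalize hMω : (μ + brₗ ω γ + (1 / 2 : ℝ) • brₗ ω (brₗ ω ψ)) = μω at *
  generalize hGω : (γ + brₗ ω ψ) = γω at *
  generalize hPω : (φ + brₗ ω μ + (1 / 2 : ℝ) • brₗ ω (brₗ ω γ) +
      (1 / 6 : ℝ) • brₗ ω (brₗ ω (brₗ ω ψ))) = φω at *
  have hproto : IsProtoLieBialgebroid μω.1 γω.1 φω.1 ψ.1 ↔
      IsProtoLieBialgebroid μ.1 γ.1 φ.1 ψ.1 := by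
    have hp : μ + γ + φ + ψ ∈ polyₗ R P :=
      add_mem (add_mem (add_mem iμ.mem_poly iγ.mem_poly) iφ.mem_poly) iψ.mem_poly
    have h := hflow.br_flow_eq_zero_iff hp 1
    rw [hX] at h
    exact ⟨fun H => ⟨hμ, hγ, hφ, hψ, h.1 H.structure_eq⟩,
      fun H => ⟨mμ, mγ, mφ, hψ, h.2 H.structure_eq⟩⟩
  -- The linear Hamiltonian is `{ω, γ}`: by definition `[ω, f]_γ = {{ω, γ}, f}`. The lowered tensors
  -- are `X_ω^j ψ / j!`.
  refine ⟨br ω.1 γ.1, _, _, _, ⟨e1, fun _ _ _ => rfl⟩, l1, l2, l3, μω.1, mμ, γω.1, mγ, φω.1, mφ,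
    hX, congrArg Subtype.val hMω.symm, congrArg Subtype.val hMω.symm, congrArg Subtype.val hGω.symm,
    congrArg Subtype.val hGω.symm, congrArg Subtype.val hPω.symm, hφω, hproto, ?_, ?_⟩
  · intro h0 hq
    rw [isQuasiLieBialgebroid_iff] at hq ⊢
    rw [h0] at hproto
    exact hproto.2 hq
  · intro h0 hq hL
    have hz : φω.1 = 0 := by
      have hL' : diff μ.1 ω.1 + (1 / 2 : ℝ) • derived γ.1 ω.1 ω.1 =
        ((1 / 6 : ℝ) • brₗ ω (brₗ ω (brₗ ω ψ))).1 := hL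
      rw [hφω, h0, ← hL']
      abel
    refine ⟨hz, ?_⟩
    rw [isDualQuasiLieBialgebroid_iff] at hq ⊢
    rw [h0, hz] at hproto
    exact hproto.2 hq

/-- The twist by `π ∈ Γ(⋀² A)`. -/
theorem twist_multivector (π : Fn R P) (hπ : π ∈ bi 2 0) :
    HasCanonicalFlow π ∧
      ∀ μ ∈ bi 1 2, ∀ γ ∈ bi 2 1, ∀ φ ∈ bi 0 3, ∀ ψ ∈ bi 3 0,
        ∃ h K₁ K₂ K₃ : Fn R P,
          IsDualLinearHamiltonian (derived μ π) h ∧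
          IsRaising 1 π φ K₁ ∧ IsRaising 2 π φ K₂ ∧ IsRaising 3 π φ K₃ ∧
          ∃ μπ ∈ bi 1 2, ∃ γπ ∈ bi 2 1, ∃ ψπ ∈ bi 3 0,
            flow π 1 (μ + γ + φ + ψ) = μπ + γπ + φ + ψπ ∧
            μπ = μ + br π φ ∧
            μπ = μ + K₁ ∧
            γπ = γ + br π μ + (1 / 2 : ℝ) • (br π)^[2] φ ∧
            γπ = γ + h + K₂ ∧
            ψπ = ψ + br π γ + (1 / 2 : ℝ) • (br π)^[2] μ + (1 / 6 : ℝ) • (br π)^[3] φ ∧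
            ψπ = ψ - diff γ π - (1 / 2 : ℝ) • derived μ π π + K₃ ∧
            (IsProtoLieBialgebroid μπ γπ φ ψπ ↔ IsProtoLieBialgebroid μ γ φ ψ) ∧
            (φ = 0 → IsDualQuasiLieBialgebroid μ γ ψ → IsDualQuasiLieBialgebroid μπ γπ ψπ) ∧
            (ψ = 0 → IsQuasiLieBialgebroid μ γ φ →
              diff γ π + (1 / 2 : ℝ) • derived μ π π = K₃ →
              ψπ = 0 ∧ IsQuasiLieBialgebroid μπ γπ φ) := by
  obtain ⟨π, rfl, iπ⟩ := exists_coe_eq hπ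
  have hflow : HasCanonicalFlow π.1 := hasCanonicalFlow_of_locallyNilpotent iπ rfl (Or.inr rfl)
    fun F hF => exists_hamₗ_pow_eq_zero iπ (Or.inr rfl) hF
  refine ⟨hflow, fun μ hμ γ hγ φ hφ ψ hψ => ?_⟩
  obtain ⟨μ, rfl, iμ⟩ := exists_coe_eq hμ
  obtain ⟨γ, rfl, iγ⟩ := exists_coe_eq hγ
  obtain ⟨φ, rfl, iφ⟩ := exists_coe_eq hφ
  obtain ⟨ψ, rfl, iψ⟩ := exists_coe_eq hψ
  have he : Even (((2 : ℕ) : ℤ) + (0 : ℕ)) := by decide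
  have e1 : br π.1 μ.1 ∈ bi 2 1 := coe_mem_bi_iff.2 ((iπ.br iμ).cast (by norm_num) (by norm_num))
  have e2 : br π.1 φ.1 ∈ bi 1 2 := coe_mem_bi_iff.2 ((iπ.br iφ).cast (by norm_num) (by norm_num))
  have e3 : br π.1 γ.1 ∈ bi 3 0 := coe_mem_bi_iff.2 ((iπ.br iγ).cast (by norm_num) (by norm_num))
  obtain ⟨f1, f2, f3⟩ := inv_factorial_smul_pow (hamₗ π) φ
  have l1 := isRaising_ham_pow iπ iφ (j := 1) (by norm_num)
  have l2 := isRaising_ham_pow iπ iφ (j := 2) (by norm_num)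
  have l3 := isRaising_ham_pow iπ iφ (j := 3) (by norm_num)
  rw [f1] at l1
  rw [f2] at l2
  rw [f3] at l3
  have hX : flow π.1 1 (μ + γ + φ + ψ).1 =
      ((μ + brₗ π φ) + (γ + brₗ π μ + (1 / 2 : ℝ) • brₗ π (brₗ π φ)) + φ +
      (ψ + brₗ π γ + (1 / 2 : ℝ) • brₗ π (brₗ π μ) +
        (1 / 6 : ℝ) • brₗ π (brₗ π (brₗ π φ)))).1 := by
    have hp : μ + γ + φ + ψ ∈ polyₗ R P :=
      add_mem (add_mem (add_mem iμ.mem_poly iγ.mem_poly) iφ.mem_poly) iψ.mem_poly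
    rw [coe_expSeries (exists_hamₗ_pow_eq_zero iπ (Or.inr rfl) hp)]
    have h0 : hamₗ π ψ = 0 := (iπ.br iψ).eq_zero (by norm_num)
    have h1 : (hamₗ π ^ 2) γ = 0 := (iπ.ham_pow iγ 2).eq_zero (by norm_num)
    have h2 : (hamₗ π ^ 3) μ = 0 := (iπ.ham_pow iμ 3).eq_zero (by norm_num)
    have h3 : (hamₗ π ^ 4) φ = 0 := (iπ.ham_pow iφ 4).eq_zero (by norm_num)
    have h := expSeries_one_of_nilpotent h0 h1 h2 h3
    -- For `π` the order is reversed: `X_π` lowers the second degree, so `ψ` is killed first and `φ`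
    -- last.
    rw [show μ + γ + φ + ψ = ψ + γ + μ + φ by abel, h]
    congr 1
    change ψ + (γ + brₗ π γ) + (μ + brₗ π μ + (1 / 2 : ℝ) • brₗ π (brₗ π μ)) +
      (φ + brₗ π φ + (1 / 2 : ℝ) • brₗ π (brₗ π φ) + (1 / 6 : ℝ) • brₗ π (brₗ π (brₗ π φ))) = _
    abel
  have hd : diff γ.1 π.1 = (-brₗ π γ).1 := congrArg Subtype.val (hamₗ_antisymm iπ he iγ.mem_poly)
  have hdd : derived μ.1 π.1 π.1 = (-brₗ π (brₗ π μ)).1 :=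
    congrArg Subtype.val (hamₗ_antisymm iπ he (brₗ_mem_polyₗ iπ.mem_poly iμ.mem_poly))
  have hψπ : (ψ + brₗ π γ + (1 / 2 : ℝ) • brₗ π (brₗ π μ) +
      (1 / 6 : ℝ) • brₗ π (brₗ π (brₗ π φ))).1 =
      ψ.1 - diff γ.1 π.1 - (1 / 2 : ℝ) • derived μ.1 π.1 π.1 +
        ((1 / 6 : ℝ) • brₗ π (brₗ π (brₗ π φ))).1 := by
    rw [hd, hdd]
    have h : ψ + brₗ π γ + (1 / 2 : ℝ) • brₗ π (brₗ π μ) + (1 / 6 : ℝ) • brₗ π (brₗ π (brₗ π φ)) =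
        ψ - -brₗ π γ - (1 / 2 : ℝ) • -brₗ π (brₗ π μ) +
          (1 / 6 : ℝ) • brₗ π (brₗ π (brₗ π φ)) := by module
    exact congrArg Subtype.val h
  have mγ : (γ + brₗ π μ + (1 / 2 : ℝ) • brₗ π (brₗ π φ)).1 ∈ bi 2 1 :=
    add_mem (add_mem hγ e1) l2.1
  have mμ : (μ + brₗ π φ).1 ∈ bi 1 2 := add_mem hμ e2
  have mψ : (ψ + brₗ π γ + (1 / 2 : ℝ) • brₗ π (brₗ π μ) +
      (1 / 6 : ℝ) • brₗ π (brₗ π (brₗ π φ))).1 ∈ bi 3 0 := by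
    refine add_mem (add_mem (add_mem hψ e3) (Submodule.smul_mem (bi 3 0) _ ?_)) l3.1
    exact coe_mem_bi_iff.2 ((iπ.br (iπ.br iμ)).cast (by norm_num) (by norm_num))
  generalize hGπ : (γ + brₗ π μ + (1 / 2 : ℝ) • brₗ π (brₗ π φ)) = γπ at *
  generalize hMπ : (μ + brₗ π φ) = μπ at *
  generalize hPπ : (ψ + brₗ π γ + (1 / 2 : ℝ) • brₗ π (brₗ π μ) +
      (1 / 6 : ℝ) • brₗ π (brₗ π (brₗ π φ))) = ψπ at *
  have hproto : IsProtoLieBialgebroid μπ.1 γπ.1 φ.1 ψπ.1 ↔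
      IsProtoLieBialgebroid μ.1 γ.1 φ.1 ψ.1 := by
    have hp : μ + γ + φ + ψ ∈ polyₗ R P :=
      add_mem (add_mem (add_mem iμ.mem_poly iγ.mem_poly) iφ.mem_poly) iψ.mem_poly
    have h := hflow.br_flow_eq_zero_iff hp 1
    rw [hX] at h
    exact ⟨fun H => ⟨hμ, hγ, hφ, hψ, h.1 H.structure_eq⟩,
      fun H => ⟨mμ, mγ, hφ, mψ, h.2 H.structure_eq⟩⟩
  refine ⟨br π.1 μ.1, _, _, _, ⟨e1, fun _ _ _ => rfl⟩, l1, l2, l3, μπ.1, mμ, γπ.1, mγ, ψπ.1, mψ,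
    hX, congrArg Subtype.val hMπ.symm, congrArg Subtype.val hMπ.symm, congrArg Subtype.val hGπ.symm,
    congrArg Subtype.val hGπ.symm, congrArg Subtype.val hPπ.symm, hψπ, hproto, ?_, ?_⟩
  · intro h0 hq
    rw [isDualQuasiLieBialgebroid_iff] at hq ⊢
    rw [h0] at hproto
    exact hproto.2 hq
  · intro h0 hq hL
    have hz : ψπ.1 = 0 := by
      have hL' : diff γ.1 π.1 + (1 / 2 : ℝ) • derived μ.1 π.1 π.1 =
        ((1 / 6 : ℝ) • brₗ π (brₗ π (brₗ π φ))).1 := hL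
      rw [hψπ, h0, ← hL']
      abel
    refine ⟨hz, ?_⟩
    rw [isQuasiLieBialgebroid_iff] at hq ⊢
    rw [h0, hz] at hproto
    exact hproto.2 hq

end Powers

end

end CotangentPiA

end

/-! ### The twists for a vector bundle, with `R = C^∞(M)` and `P = Γ(A)`. -/

theorem mainTheorem2
    {E : Type*} [NormedAddCommGroup E] [NormedSpace ℝ E] [FiniteDimensional ℝ E]
    {H : Type*} [TopologicalSpace H] (I : ModelWithCorners ℝ E H) [I.Boundaryless]
    {M : Type*} [TopologicalSpace M] [ChartedSpace H M] [IsManifold I ((⊤ : ℕ∞) : WithTop ℕ∞) M]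
    [T2Space M] [SigmaCompactSpace M]
    (F : Type*) [NormedAddCommGroup F] [NormedSpace ℝ F] [FiniteDimensional ℝ F]
    (A : M → Type*) [TopologicalSpace (Bundle.TotalSpace F A)]
    [∀ x, AddCommGroup (A x)] [∀ x, Module ℝ (A x)] [∀ x, TopologicalSpace (A x)]
    [FiberBundle F A] [VectorBundle ℝ F A] [ContMDiffVectorBundle ((⊤ : ℕ∞) : WithTop ℕ∞) F A I] :
    -- twisting by `ω ∈ Γ(⋀² A^*)`
    (∀ ω : BundleFn I F A, ω ∈ bi 0 2 →
      HasCanonicalFlow ω ∧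
      ∀ μ ∈ bi 1 2, ∀ γ ∈ bi 2 1, ∀ φ ∈ bi 0 3, ∀ ψ ∈ bi 3 0,
        ∃ h L₁ L₂ L₃ : BundleFn I F A,
          IsLinearHamiltonian (derived γ ω) h ∧
          IsLowering 1 ω ψ L₁ ∧ IsLowering 2 ω ψ L₂ ∧ IsLowering 3 ω ψ L₃ ∧
          ∃ μω ∈ bi 1 2, ∃ γω ∈ bi 2 1, ∃ φω ∈ bi 0 3,
            flow ω 1 (μ + γ + φ + ψ) = μω + γω + φω + ψ ∧
            μω = μ + br ω γ + (1 / 2 : ℝ) • (br ω)^[2] ψ ∧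
            μω = μ + h + L₂ ∧
            γω = γ + br ω ψ ∧
            γω = γ + L₁ ∧
            φω = φ + br ω μ + (1 / 2 : ℝ) • (br ω)^[2] γ + (1 / 6 : ℝ) • (br ω)^[3] ψ ∧
            φω = φ - diff μ ω - (1 / 2 : ℝ) • derived γ ω ω + L₃ ∧
            (IsProtoLieBialgebroid μω γω φω ψ ↔ IsProtoLieBialgebroid μ γ φ ψ) ∧
            (ψ = 0 → IsQuasiLieBialgebroid μ γ φ → IsQuasiLieBialgebroid μω γω φω) ∧
            (φ = 0 → IsDualQuasiLieBialgebroid μ γ ψ →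
              diff μ ω + (1 / 2 : ℝ) • derived γ ω ω = L₃ →
              φω = 0 ∧ IsDualQuasiLieBialgebroid μω γω ψ)) ∧
    -- twisting by `π ∈ Γ(⋀² A)`
    (∀ π : BundleFn I F A, π ∈ bi 2 0 →
      HasCanonicalFlow π ∧
      ∀ μ ∈ bi 1 2, ∀ γ ∈ bi 2 1, ∀ φ ∈ bi 0 3, ∀ ψ ∈ bi 3 0,
        ∃ h K₁ K₂ K₃ : BundleFn I F A,
          IsDualLinearHamiltonian (derived μ π) h ∧
          IsRaising 1 π φ K₁ ∧ IsRaising 2 π φ K₂ ∧ IsRaising 3 π φ K₃ ∧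
          ∃ μπ ∈ bi 1 2, ∃ γπ ∈ bi 2 1, ∃ ψπ ∈ bi 3 0,
            flow π 1 (μ + γ + φ + ψ) = μπ + γπ + φ + ψπ ∧
            μπ = μ + br π φ ∧
            μπ = μ + K₁ ∧
            γπ = γ + br π μ + (1 / 2 : ℝ) • (br π)^[2] φ ∧
            γπ = γ + h + K₂ ∧
            ψπ = ψ + br π γ + (1 / 2 : ℝ) • (br π)^[2] μ + (1 / 6 : ℝ) • (br π)^[3] φ ∧
            ψπ = ψ - diff γ π - (1 / 2 : ℝ) • derived μ π π + K₃ ∧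
            (IsProtoLieBialgebroid μπ γπ φ ψπ ↔ IsProtoLieBialgebroid μ γ φ ψ) ∧
            (φ = 0 → IsDualQuasiLieBialgebroid μ γ ψ → IsDualQuasiLieBialgebroid μπ γπ ψπ) ∧
            (ψ = 0 → IsQuasiLieBialgebroid μ γ φ →
              diff γ π + (1 / 2 : ℝ) • derived μ π π = K₃ →
              ψπ = 0 ∧ IsQuasiLieBialgebroid μπ γπ φ)) :=
  ⟨fun ω hω => twist_form ω hω, fun π hπ => twist_multivector π hπ⟩
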